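/- Let $X$ be a topological space and $\mathcal G$ a sheaf of groups on $X$. A *sheaf of AQ normal series* is a descending sequence $\mathcal G=\mathcal H_0\supseteq\mathcal H_1\supseteq\mathcal H_2\supseteq\cdots$ of subsheaves of normal subgroups of $\mathcal G$ such that every quotient sheaf $\mathcal A_j=\mathcal H_j/\mathcal H_{j+1}$ is abelian. It is *central* if for every $j>0$ there is an index $k<j$ such that $\mathcal A_j$ is contained in the centre of $\mathcal H_k/\mathcal H_{j+1}$. Let $\mathcal H=(\mathcal H_j)_{j\ge 0}$ be a sheaf of AQ central series on $X$, and for each $j>0$ fix such an index $k=k(j)<j$ (the choice is arbitrary). *Primary complex.* For $j\ge 0$ put $k=k(j+1)\le j$. The central extension of sheaves of groups $$1\to\mathcal A_{j+1}\to\mathcal H_k/\mathcal H_{j+2}\to\mathcal H_k/\mathcal H_{j+1}\to 1$$ has connecting maps $\delta^1:H^0(X,\mathcal H_k/\mathcal H_{j+1})\to H^1(X,\mathcal A_{j+1})$ and $\delta^2:\check H^1(X,\mathcal H_k/\mathcal H_{j+1})\to H^2(X,\mathcal A_{j+1})$. Composing them with the maps on cohomology induced by the inclusion $\mathcal A_j\subseteq\mathcal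 H_k/\mathcal H_{j+1}$ gives maps of pointed sets $$\partial: H^0(X,\mathcal A_j)\to H^1(X,\mathcal A_{j+1}),\qquad \partial: H^1(X,\mathcal A_j)\to H^2(X,\mathcal A_{j+1}).$$ With $\mathcal A_{-1}=0$, the *first primary cohomology* of $\mathcal H$ has as its component of degree $j\ge 0$ the pointed set obtained from $\ker\big(\partial:H^1(X,\mathcal A_j)\to H^2(X,\mathcal A_{j+1})\big)$ by collapsing to a point the image of $\partial:H^0(X,\mathcal A_{j-1})\to H^1(X,\mathcal A_j)$. It *vanishes* if each of these components is a single point, i.e. if kernel and image agree for every $j\ge 0$. *Linearisation.* An $\mathcal H_j$-torsor is a class in $\check H^1(X,\mathcal H_j)$, and its linearisation is its image under the map $\check H^1(X,\mathcal H_j)\to H^1(X,\mathcal A_j)$ induced by the projection $\mathcal H_j\to\mathcal A_j$. **Theorem.** 1. For every $j\ge 0$ and every $\theta\in H^1(X,\mathcal A_j)$: if $\theta$ is the linearisation of some $\mathcal H_j$-torsor, then $\partial\theta=0$ in $H^2(X,\mathcal A_{j+1})$. (No vanishing hypothesis is made here.) 2. Suppose that the first primary cohomology of $\mathcal H$ vanishes.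 Then for every $j\ge 0$ and every $\theta\in H^1(X,\mathcal A_j)$: $\theta$ is the linearisation of some $\mathcal H_j$-torsor if and only if $\partial\theta=0$. -/

import Mathlib

open CategoryTheory TopologicalSpace Opposite

universe u

namespace AQ

noncomputable section

variable {X : TopCat.{u}}

/-- Sheaves of groups on `X`. -/
abbrev GrpSheaf (X : TopCat.{u}) := Sheaf (Opens.grothendieckTopology X) GrpCat.{u}

/-- Sheaves of abelian groups on `X`. -/
abbrev AbSheaf (X : TopCat.{u}) := Sheaf (Opens.grothendieckTopology X) AddCommGrpCat.{u}

/-- The group of sections of a sheaf of groups over an open set. -/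
abbrev Sec (F : GrpSheaf X) (U : Opens X) : Type u := F.obj.obj (op U)

/-- Restriction of sections. -/
def res (F : GrpSheaf X) {U V : Opens X} (h : V ≤ U) : Sec F U →* Sec F V :=
  (F.obj.map (homOfLE h).op).hom

/-- The action of a morphism of sheaves of groups on sections. -/
def ap {F G : GrpSheaf X} (f : F ⟶ G) (U : Opens X) : Sec F U →* Sec G U :=
  (f.hom.app (op U)).hom

lemma res_self (F : GrpSheaf X) {U : Opens X} (s : Sec F U) : res F (le_refl U) s = s := by
  simp [res]

lemma res_res (F : GrpSheaf X) {U V W : Opens X} (h : V ≤ U) (h' : W ≤ V) (s : Sec F U) :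
    res F h' (res F h s) = res F (h'.trans h) s := by
  have : (homOfLE (h'.trans h)).op = (homOfLE h).op ≫ (homOfLE h').op := rfl
  simp [res, this]

lemma ap_res {F G : GrpSheaf X} (f : F ⟶ G) {U V : Opens X} (h : V ≤ U) (s : Sec F U) :
    ap f V (res F h s) = res G h (ap f U s) :=
  ConcreteCategory.congr_hom (f.hom.naturality (homOfLE h).op) s

/-- Two sections which agree locally are equal. -/
lemma sec_ext (F : GrpSheaf X) {U : Opens X} (s t : Sec F U)
    (h : ∀ p ∈ U, ∃ (V : Opens X) (hV : V ≤ U), p ∈ V ∧ res F hV s = res F hV t) : s = t := by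
  choose V hV hp hst using h
  refine TopCat.Sheaf.eq_of_locally_eq' (C := GrpCat.{u}) F (fun p : U => V p.1 p.2) U
    (fun p => homOfLE (hV p.1 p.2)) ?_ s t (fun p => hst p.1 p.2)
  intro p hpU
  exact Opens.mem_iSup.mpr ⟨⟨p, hpU⟩, hp p hpU⟩

/-- Gluing of sections which are given near each point. -/
lemma sec_glue (F : GrpSheaf X) {U : Opens X} (V : U → Opens X) (hV : ∀ p, V p ≤ U)
    (hp : ∀ p : U, p.1 ∈ V p) (s : ∀ p, Sec F (V p))
    (h : ∀ p q, res F (inf_le_left : V p ⊓ V q ≤ V p) (s p) =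
      res F (inf_le_right : V p ⊓ V q ≤ V q) (s q)) :
    ∃ t : Sec F U, ∀ p, res F (hV p) t = s p := by
  obtain ⟨t, ht, -⟩ := TopCat.Sheaf.existsUnique_gluing' (C := GrpCat.{u}) F V U
    (fun p => homOfLE (hV p)) (fun p hpU => Opens.mem_iSup.mpr ⟨⟨p, hpU⟩, hp ⟨p, hpU⟩⟩) s h
  exact ⟨t, ht⟩

/-! ### Germs -/

/-- Open neighbourhoods of a point, ordered by reverse inclusion. -/
abbrev Nhd (p : X) : Type u := {U : Opens X // p ∈ U}ᵒᵈ

instance (p : X) : IsDirectedOrder (Nhd p) where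
  directed a b := ⟨OrderDual.toDual ⟨(OrderDual.ofDual a).1 ⊓ (OrderDual.ofDual b).1,
    (OrderDual.ofDual a).2, (OrderDual.ofDual b).2⟩,
    show _ ≤ (OrderDual.ofDual a).1 from inf_le_left,
    show _ ≤ (OrderDual.ofDual b).1 from inf_le_right⟩

instance (p : X) : Nonempty (Nhd p) := ⟨OrderDual.toDual ⟨⊤, trivial⟩⟩

/-- Sections of `F` over the neighbourhoods of `p`. -/
abbrev nhdSec (F : GrpSheaf X) (p : X) (a : Nhd p) : Type u := Sec F (OrderDual.ofDual a).1

/-- Restriction between neighbourhoods of `p`. -/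
def nhdRes (F : GrpSheaf X) (p : X) (a b : Nhd p) (h : a ≤ b) : nhdSec F p a →* nhdSec F p b :=
  res F (show (OrderDual.ofDual b).1 ≤ (OrderDual.ofDual a).1 from h)

instance (F : GrpSheaf X) (p : X) : DirectedSystem (nhdSec F p) (nhdRes F p · · ·) where
  map_self _ x := res_self F x
  map_map _ _ _ _ _ x := res_res F _ _ x

/-- The stalk of a sheaf of groups. -/
abbrev Stalk (F : GrpSheaf X) (p : X) : Type u := DirectLimit (nhdSec F p) (nhdRes F p)

/-- The germ at `p` of a section over an open set containing `p`. -/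
def germ (F : GrpSheaf X) {U : Opens X} (p : X) (hp : p ∈ U) : Sec F U →* Stalk F p where
  toFun s := ⟦⟨OrderDual.toDual ⟨U, hp⟩, s⟩⟧
  map_one' := (DirectLimit.one_def (f := nhdRes F p) (OrderDual.toDual ⟨U, hp⟩)).symm
  map_mul' s t := (DirectLimit.mul_def (f := nhdRes F p) (OrderDual.toDual ⟨U, hp⟩) s t).symm

lemma germ_res (F : GrpSheaf X) {U V : Opens X} (h : V ≤ U) (p : X) (hp : p ∈ V) (s : Sec F U) :
    germ F p hp (res F h s) = germ F p (h hp) s := by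
  have h' : (OrderDual.toDual ⟨U, h hp⟩ : Nhd p) ≤ OrderDual.toDual ⟨V, hp⟩ := h
  exact DirectLimit.mk_apply (f := nhdRes F p) (OrderDual.toDual ⟨U, h hp⟩)
    (OrderDual.toDual ⟨V, hp⟩) s h'

lemma exists_germ (F : GrpSheaf X) {p : X} (z : Stalk F p) :
    ∃ (U : Opens X) (hp : p ∈ U) (s : Sec F U), germ F p hp s = z := by
  obtain ⟨a, s, rfl⟩ := DirectLimit.exists_eq_mk (nhdRes F p) z
  exact ⟨_, (OrderDual.ofDual a).2, s, rfl⟩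

lemma germ_eq (F : GrpSheaf X) {U V : Opens X} {p : X} (hU : p ∈ U) (hV : p ∈ V)
    (s : Sec F U) (t : Sec F V) (h : germ F p hU s = germ F p hV t) :
    ∃ (W : Opens X) (h₁ : W ≤ U) (h₂ : W ≤ V), p ∈ W ∧ res F h₁ s = res F h₂ t := by
  obtain ⟨c, h₁, h₂, e⟩ := Quotient.exact h
  exact ⟨(OrderDual.ofDual c).1, h₁, h₂, (OrderDual.ofDual c).2, e⟩

/-- The map induced on stalks by a morphism of sheaves of groups. -/
def stalkMap {F G : GrpSheaf X} (f : F ⟶ G) (p : X) : Stalk F p →* Stalk G p where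
  toFun := DirectLimit.map (nhdRes F p) (nhdRes G p) (fun _ => ap f _)
    (fun _ _ _ s => (ap_res f _ s).symm)
  map_one' := by
    rw [← map_one (germ F p (U := ⊤) trivial), ← map_one (germ G p (U := ⊤) trivial),
      ← map_one (ap f ⊤)]
    rfl
  map_mul' := by
    intro z w
    obtain ⟨a, s, t, rfl, rfl⟩ := DirectLimit.exists_eq_mk₂ (nhdRes F p) z w
    have h₁ := (germ F p (OrderDual.ofDual a).2).map_mul s t
    have h₂ := (germ G p (OrderDual.ofDual a).2).map_mul (ap f _ s) (ap f _ t)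
    rw [← map_mul] at h₂
    exact (congrArg (DirectLimit.map (nhdRes F p) (nhdRes G p) (fun _ => ap f _)
      (fun _ _ _ s => (ap_res f _ s).symm)) h₁.symm).trans h₂

lemma stalkMap_germ {F G : GrpSheaf X} (f : F ⟶ G) {U : Opens X} (p : X) (hp : p ∈ U)
    (s : Sec F U) : stalkMap f p (germ F p hp s) = germ G p hp (ap f U s) := rfl

lemma sec_ext_germ (F : GrpSheaf X) {U : Opens X} (s t : Sec F U)
    (h : ∀ p (hp : p ∈ U), germ F p hp s = germ F p hp t) : s = t := by
  refine sec_ext F s t fun p hp => ?_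
  obtain ⟨W, h₁, h₂, hW, e⟩ := germ_eq F hp hp s t (h p hp)
  exact ⟨W, h₁, hW, e⟩

/-! ### Subsheaves of groups and products over the points -/

/-- A subsheaf of groups of a sheaf of groups. -/
structure SubgrpSheaf (F : GrpSheaf X) where
  /-- the subgroup of sections over each open set -/
  sec : ∀ U : Opens X, Subgroup (Sec F U)
  /-- it is stable under restriction -/
  res_mem : ∀ {U V : Opens X} (h : V ≤ U) {s : Sec F U}, s ∈ sec U → res F h s ∈ sec V
  /-- membership is a local condition -/
  local_mem : ∀ {U : Opens X} (s : Sec F U),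
    (∀ p ∈ U, ∃ (V : Opens X) (hV : V ≤ U), p ∈ V ∧ res F hV s ∈ sec V) → s ∈ sec U

/-- A presheaf of groups, given by its sections and restriction maps, which is a sheaf. -/
def mkGrpSheaf (S : Opens X → Type u) [∀ U, Group (S U)]
    (r : ∀ {U V : Opens X}, V ≤ U → (S U →* S V))
    (r_self : ∀ {U : Opens X} (s : S U), r (le_refl U) s = s)
    (r_r : ∀ {U V W : Opens X} (h : V ≤ U) (h' : W ≤ V) (s : S U), r h' (r h s) = r (h'.trans h) s)
    (glue : ∀ {ι : Type u} (U : ι → Opens X) (s : ∀ i, S (U i)),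
      (∀ i j, r (inf_le_left : U i ⊓ U j ≤ U i) (s i) = r (inf_le_right : U i ⊓ U j ≤ U j) (s j)) →
      ∃! t : S (iSup U), ∀ i, r (le_iSup U i) t = s i) : GrpSheaf X where
  obj :=
    { obj U := GrpCat.of (S U.unop)
      map f := GrpCat.ofHom (r f.unop.le)
      map_id U := by ext s; exact r_self s
      map_comp f g := by ext s; exact (r_r _ _ s).symm }
  property := (TopCat.Presheaf.isSheaf_iff_isSheafUniqueGluing (C := GrpCat.{u}) _).mpr
    fun _ U s h => glue U s h

/-- A subsheaf of groups as a sheaf of groups. -/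
def SubgrpSheaf.toSheaf {F : GrpSheaf X} (H : SubgrpSheaf F) : GrpSheaf X :=
  mkGrpSheaf (fun U => H.sec U)
    (fun {U V} h => ((res F h).comp (H.sec U).subtype).codRestrict (H.sec V)
      (fun s => H.res_mem h s.2))
    (fun s => Subtype.ext (res_self F s.1))
    (fun h h' s => Subtype.ext (res_res F h h' s.1))
    (by
      intro ι U s hs
      obtain ⟨t, ht, hu⟩ := TopCat.Sheaf.existsUnique_gluing (C := GrpCat.{u}) F U
        (fun i => (s i).1) (fun i j => congrArg Subtype.val (hs i j))
      have ht' : ∀ i, res F (le_iSup U i) t = (s i).1 := ht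
      refine ⟨⟨t, H.local_mem t fun p hp => ?_⟩, fun i => Subtype.ext (ht i), ?_⟩
      · obtain ⟨i, hi⟩ := Opens.mem_iSup.mp hp
        exact ⟨U i, le_iSup U i, hi, by rw [ht']; exact (s i).2⟩
      · intro t' h'
        exact Subtype.ext (hu t'.1 fun i => congrArg Subtype.val (h' i)))

/-- The inclusion of a subsheaf of groups. -/
def SubgrpSheaf.incl {F : GrpSheaf X} (H : SubgrpSheaf F) : H.toSheaf ⟶ F :=
  ⟨{ app := fun U => GrpCat.ofHom (H.sec U.unop).subtype
     naturality := fun _ _ _ => rfl }⟩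

/-- The sheaf whose sections over `U` are all the families `(g p)` with `p ∈ U` and `g p ∈ G p`. -/
def piSheaf (G : X → Type u) [∀ p, Group (G p)] : GrpSheaf X :=
  mkGrpSheaf (fun U => ∀ p : U, G p.1)
    (fun {U V} h => MonoidHom.pi fun p : V => Pi.evalMonoidHom (fun p : U => G p.1) ⟨p.1, h p.2⟩)
    (fun _ => rfl) (fun _ _ _ => rfl)
    (by
      intro ι U s hs
      have hmem : ∀ p : (iSup U : Opens X), ∃ i, p.1 ∈ U i := fun p => Opens.mem_iSup.mp p.2
      choose i hi using hmem
      have key : ∀ (p : X) (a b : ι) (ha : p ∈ U a) (hb : p ∈ U b), s a ⟨p, ha⟩ = s b ⟨p, hb⟩ :=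
        fun p a b ha hb => congrFun (hs a b) ⟨p, ha, hb⟩
      refine ⟨fun p => s (i p) ⟨p.1, hi p⟩, fun j => funext fun p => key _ _ _ _ _, ?_⟩
      intro t ht
      funext p
      exact congrFun (ht (i p)) ⟨p.1, hi p⟩)

/-! ### Images in products, quotient sheaves -/

/-- A morphism to a product sheaf, given on stalks. -/
def toPi {F : GrpSheaf X} {G : X → Type u} [∀ p, Group (G p)] (φ : ∀ p, Stalk F p →* G p) :
    F ⟶ piSheaf G :=
  ⟨{ app := fun U => GrpCat.ofHom (Y := (∀ p : U.unop, G p.1))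
        (MonoidHom.pi fun p : U.unop => (φ p.1).comp (germ F p.1 p.2))
     naturality := by
        intro U V f
        ext s
        funext p
        exact congrArg (φ p.1) (germ_res F f.unop.le p.1 p.2 s) }⟩

/-- The image of a sheaf in a product sheaf: the families which locally come from a section. -/
def imageSheaf {F : GrpSheaf X} {G : X → Type u} [∀ p, Group (G p)] (φ : ∀ p, Stalk F p →* G p) :
    SubgrpSheaf (piSheaf G) where
  sec U :=
    { carrier := {s | ∀ p ∈ U, ∃ (V : Opens X) (hV : V ≤ U), p ∈ V ∧
        ∃ t : Sec F V, res (piSheaf G) hV s = ap (toPi φ) V t}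
      one_mem' := fun p hp => ⟨U, le_refl U, hp, 1, by rw [map_one, map_one]⟩
      mul_mem' := by
        intro a b ha hb p hp
        obtain ⟨V, hV, hpV, s, hs⟩ := ha p hp
        obtain ⟨W, hW, hpW, t, ht⟩ := hb p hp
        refine ⟨V ⊓ W, inf_le_left.trans hV, ⟨hpV, hpW⟩,
          res F inf_le_left s * res F inf_le_right t, ?_⟩
        rw [map_mul, map_mul, ap_res, ap_res, ← hs, ← ht, res_res, res_res]
      inv_mem' := by
        intro a ha p hp
        obtain ⟨V, hV, hpV, s, hs⟩ := ha p hp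
        exact ⟨V, hV, hpV, s⁻¹, by rw [map_inv, map_inv, hs]⟩ }
  res_mem := by
    intro U V h s hs p hp
    obtain ⟨W, hW, hpW, t, ht⟩ := hs p (h hp)
    refine ⟨V ⊓ W, inf_le_left, ⟨hp, hpW⟩, res F inf_le_right t, ?_⟩
    rw [ap_res, ← ht, res_res, res_res]
  local_mem := by
    intro U s hs p hp
    obtain ⟨V, hV, hpV, h⟩ := hs p hp
    obtain ⟨W, hW, hpW, t, ht⟩ := h p hpV
    exact ⟨W, hW.trans hV, hpW, t, by rw [← ht, res_res]⟩

/-- The subgroup of the stalk formed by the germs of the sections of a subsheaf. -/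
def SubgrpSheaf.stalk {F : GrpSheaf X} (N : SubgrpSheaf F) (p : X) : Subgroup (Stalk F p) where
  carrier := {z | ∃ (U : Opens X) (hp : p ∈ U) (s : Sec F U), s ∈ N.sec U ∧ germ F p hp s = z}
  one_mem' := ⟨⊤, trivial, 1, one_mem _, map_one _⟩
  mul_mem' := by
    rintro _ _ ⟨U, hU, s, hs, rfl⟩ ⟨V, hV, t, ht, rfl⟩
    have hUV : p ∈ U ⊓ V := ⟨hU, hV⟩
    refine ⟨U ⊓ V, hUV, res F inf_le_left s * res F inf_le_right t,
      mul_mem (N.res_mem _ hs) (N.res_mem _ ht), ?_⟩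
    rw [map_mul, germ_res, germ_res]
  inv_mem' := by
    rintro _ ⟨U, hU, s, hs, rfl⟩
    exact ⟨U, hU, s⁻¹, inv_mem hs, map_inv _ _⟩

lemma SubgrpSheaf.germ_mem {F : GrpSheaf X} (N : SubgrpSheaf F) {U : Opens X} {p : X} (hp : p ∈ U)
    (s : Sec F U) (h : germ F p hp s ∈ N.stalk p) :
    ∃ (V : Opens X) (hV : V ≤ U), p ∈ V ∧ res F hV s ∈ N.sec V := by
  obtain ⟨V, hV, t, ht, e⟩ := h
  obtain ⟨W, h₁, h₂, hW, e'⟩ := germ_eq F hV hp t s e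
  exact ⟨W, h₂, hW, e' ▸ N.res_mem h₁ ht⟩

/-- A subsheaf of normal subgroups. -/
class SubgrpSheaf.Normal {F : GrpSheaf X} (N : SubgrpSheaf F) : Prop where
  normal : ∀ U, (N.sec U).Normal

instance {F : GrpSheaf X} (N : SubgrpSheaf F) [hN : N.Normal] (p : X) : (N.stalk p).Normal where
  conj_mem := by
    rintro _ ⟨U, hU, s, hs, rfl⟩ z
    obtain ⟨V, hV, t, rfl⟩ := exists_germ F z
    have hUV : p ∈ U ⊓ V := ⟨hU, hV⟩
    refine ⟨U ⊓ V, hUV, res F inf_le_right t * res F inf_le_left s * (res F inf_le_right t)⁻¹,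
      (hN.normal _).conj_mem _ (N.res_mem _ hs) _, ?_⟩
    rw [map_mul, map_mul, map_inv, germ_res, germ_res]

/-- The quotient sheaf `F / N` by a subsheaf of normal subgroups: the sheaf associated with
`U ↦ F(U) / N(U)`, realised as the families of elements of `F_p / N_p` which locally come from a
section of `F`. -/
def quot {F : GrpSheaf X} (N : SubgrpSheaf F) [N.Normal] : GrpSheaf X :=
  (imageSheaf fun p => QuotientGroup.mk' (N.stalk p)).toSheaf

/-- The projection onto the quotient sheaf. -/
def quotProj {F : GrpSheaf X} (N : SubgrpSheaf F) [N.Normal] : F ⟶ quot N :=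
  ⟨{ app := fun U => GrpCat.ofHom
        ((ap (toPi fun p => QuotientGroup.mk' (N.stalk p)) U.unop).codRestrict
          ((imageSheaf fun p => QuotientGroup.mk' (N.stalk p)).sec U.unop)
          (fun s p hp => ⟨U.unop, le_refl _, hp, s, res_self _ _⟩))
     naturality := by
        intro U V f
        ext s
        exact Subtype.ext (ap_res (toPi fun p => QuotientGroup.mk' (N.stalk p)) f.unop.le s) }⟩

/-- The underlying family of a section of a quotient sheaf. -/
def quotVal {F : GrpSheaf X} (N : SubgrpSheaf F) [N.Normal] {U : Opens X} (s : Sec (quot N) U)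
    (p : X) (hp : p ∈ U) : Stalk F p ⧸ N.stalk p :=
  (show ∀ p : U, Stalk F p.1 ⧸ N.stalk p.1 from (s : Subtype _).1) ⟨p, hp⟩

lemma quotVal_ext {F : GrpSheaf X} (N : SubgrpSheaf F) [N.Normal] {U : Opens X}
    {s t : Sec (quot N) U} (h : ∀ p hp, quotVal N s p hp = quotVal N t p hp) : s = t :=
  Subtype.ext (funext fun p : U => h p.1 p.2)

lemma quotVal_proj {F : GrpSheaf X} (N : SubgrpSheaf F) [N.Normal] {U : Opens X} (s : Sec F U)
    (p : X) (hp : p ∈ U) : quotVal N (ap (quotProj N) U s) p hp = (germ F p hp s : Stalk F p) :=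
  rfl

lemma quotVal_one {F : GrpSheaf X} (N : SubgrpSheaf F) [N.Normal] {U : Opens X}
    (p : X) (hp : p ∈ U) : quotVal N (1 : Sec (quot N) U) p hp = 1 := rfl

lemma quotVal_res {F : GrpSheaf X} (N : SubgrpSheaf F) [N.Normal] {U V : Opens X} (h : V ≤ U)
    (s : Sec (quot N) U) (p : X) (hp : p ∈ V) :
    quotVal N (res (quot N) h s) p hp = quotVal N s p (h hp) := rfl

/-- Every section of the quotient sheaf lifts locally. -/
lemma quot_local {F : GrpSheaf X} (N : SubgrpSheaf F) [N.Normal] {U : Opens X} (s : Sec (quot N) U)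
    (p : X) (hp : p ∈ U) : ∃ (V : Opens X) (hV : V ≤ U), p ∈ V ∧
      ∃ t : Sec F V, ap (quotProj N) V t = res (quot N) hV s := by
  obtain ⟨V, hV, hpV, t, ht⟩ := (s : Subtype _).2 p hp
  exact ⟨V, hV, hpV, t, Subtype.ext ht.symm⟩

lemma quotProj_eq_one {F : GrpSheaf X} (N : SubgrpSheaf F) [N.Normal] {U : Opens X} (s : Sec F U) :
    ap (quotProj N) U s = 1 ↔ s ∈ N.sec U := by
  constructor
  · intro h
    refine N.local_mem s fun p hp => N.germ_mem hp s ?_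
    rw [← QuotientGroup.eq_one_iff, ← quotVal_proj N s p hp, h, quotVal_one]
  · intro h
    refine quotVal_ext N fun p hp => ?_
    rw [quotVal_proj, quotVal_one, QuotientGroup.eq_one_iff]
    exact ⟨U, hp, s, h, rfl⟩

lemma stalkMap_mem {F G : GrpSheaf X} (f : F ⟶ G) (N : SubgrpSheaf F) (M : SubgrpSheaf G)
    (h : ∀ U, ∀ s ∈ N.sec U, ap f U s ∈ M.sec U) (p : X) :
    N.stalk p ≤ (M.stalk p).comap (stalkMap f p) := by
  rintro _ ⟨U, hU, s, hs, rfl⟩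
  exact ⟨U, hU, ap f U s, h U s hs, rfl⟩

/-- The morphism induced on quotient sheaves. -/
def quotMap {F G : GrpSheaf X} (f : F ⟶ G) (N : SubgrpSheaf F) (M : SubgrpSheaf G) [N.Normal]
    [M.Normal] (h : ∀ U, ∀ s ∈ N.sec U, ap f U s ∈ M.sec U) : quot N ⟶ quot M :=
  ⟨{ app := fun U => GrpCat.ofHom
        (((MonoidHom.pi fun p : U.unop => (QuotientGroup.map _ _ (stalkMap f p.1)
            (stalkMap_mem f N M h p.1)).comp
              (Pi.evalMonoidHom (fun p : U.unop => Stalk F p.1 ⧸ N.stalk p.1) p)).comp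
          ((imageSheaf fun p => QuotientGroup.mk' (N.stalk p)).sec U.unop).subtype).codRestrict
          ((imageSheaf fun p => QuotientGroup.mk' (M.stalk p)).sec U.unop)
          (by
            intro s p hp
            obtain ⟨V, hV, hpV, t, ht⟩ := s.2 p hp
            refine ⟨V, hV, hpV, ap f V t, ?_⟩
            funext q
            have := congrFun ht q
            exact congrArg (QuotientGroup.map _ _ (stalkMap f q.1)
              (stalkMap_mem f N M h q.1)) this))
     naturality := fun _ _ _ => rfl }⟩

lemma quotVal_map {F G : GrpSheaf X} (f : F ⟶ G) (N : SubgrpSheaf F) (M : SubgrpSheaf G) [N.Normal]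
    [M.Normal] (h : ∀ U, ∀ s ∈ N.sec U, ap f U s ∈ M.sec U) {U : Opens X} (s : Sec (quot N) U)
    (p : X) (hp : p ∈ U) :
    quotVal M (ap (quotMap f N M h) U s) p hp =
      QuotientGroup.map _ _ (stalkMap f p) (stalkMap_mem f N M h p) (quotVal N s p hp) := rfl

lemma quotMap_proj {F G : GrpSheaf X} (f : F ⟶ G) (N : SubgrpSheaf F) (M : SubgrpSheaf G) [N.Normal]
    [M.Normal] (h : ∀ U, ∀ s ∈ N.sec U, ap f U s ∈ M.sec U) {U : Opens X} (s : Sec F U) :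
    ap (quotMap f N M h) U (ap (quotProj N) U s) = ap (quotProj M) U (ap f U s) := rfl

/-! ### Short exact sequences -/

/-- Exactness of `1 ⟶ A ⟶ B ⟶ C ⟶ 1` as a sequence of sheaves of groups. -/
structure IsShortExact {A B C : GrpSheaf X} (i : A ⟶ B) (π : B ⟶ C) : Prop where
  inj : ∀ U, Function.Injective (ap i U)
  exact : ∀ U (b : Sec B U), ap π U b = 1 ↔ ∃ a, ap i U a = b
  surj : ∀ U (c : Sec C U), ∀ p ∈ U, ∃ (V : Opens X) (hV : V ≤ U), p ∈ V ∧
    ∃ b : Sec B V, ap π V b = res C hV c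

lemma mem_range_of_local {A B : GrpSheaf X} (i : A ⟶ B) (hi : ∀ U, Function.Injective (ap i U))
    {U : Opens X} (b : Sec B U) (h : ∀ p ∈ U, ∃ (V : Opens X) (hV : V ≤ U), p ∈ V ∧
      ∃ a : Sec A V, ap i V a = res B hV b) : ∃ a, ap i U a = b := by
  choose V hV hpV a ha using h
  obtain ⟨t, ht⟩ := sec_glue A (fun p : U => V p.1 p.2) (fun p => hV p.1 p.2)
    (fun p => hpV p.1 p.2) (fun p => a p.1 p.2) (fun p q => hi _ (by
      rw [ap_res, ap_res, ha, ha, res_res, res_res]))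
  refine ⟨t, sec_ext B _ _ fun p hp => ⟨V p hp, hV p hp, hpV p hp, ?_⟩⟩
  rw [← ap_res, ht ⟨p, hp⟩, ha]

/-- `M/N ⟶ F/N ⟶ F/P` is exact when `M ⟶ F` is a monomorphism with image `P`. -/
lemma isShortExact_quot {M F : GrpSheaf X} (m : M ⟶ F)
    (N' : SubgrpSheaf M) (N P : SubgrpSheaf F) [N'.Normal] [N.Normal] [P.Normal]
    (hN : ∀ U s, s ∈ N'.sec U ↔ ap m U s ∈ N.sec U)
    (hN' : ∀ U, ∀ s ∈ N'.sec U, ap m U s ∈ N.sec U)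
    (hNP : ∀ U, ∀ s ∈ N.sec U, ap (𝟙 F) U s ∈ P.sec U)
    (hP : ∀ U s, s ∈ P.sec U ↔ ∃ t, ap m U t = s) :
    IsShortExact (quotMap m N' N hN')
      (quotMap (𝟙 F) N P hNP) := by
  have inj : ∀ U, Function.Injective (ap (quotMap m N' N hN') U) := by
    intro U
    rw [injective_iff_map_eq_one]
    intro s hs
    refine sec_ext _ _ _ fun p hp => ?_
    obtain ⟨V, hV, hpV, t, ht⟩ := quot_local N' s p hp
    refine ⟨V, hV, hpV, ?_⟩
    rw [← ht, map_one, quotProj_eq_one, hN, ← quotProj_eq_one,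
      ← quotMap_proj m N' N hN', ht, ap_res, hs, map_one]
  refine ⟨inj, ?_, ?_⟩
  · intro U b
    constructor
    · intro hb
      refine mem_range_of_local _ inj b fun p hp => ?_
      obtain ⟨V, hV, hpV, f, hf⟩ := quot_local N b p hp
      have hfP : f ∈ P.sec V := by
        have : ap (quotMap (𝟙 F) N P hNP) V (ap (quotProj N) V f) = 1 := by
          rw [hf, ap_res, hb, map_one]
        rw [quotMap_proj, quotProj_eq_one] at this
        exact this
      obtain ⟨t, rfl⟩ := (hP V f).1 hfP
      exact ⟨V, hV, hpV, ap (quotProj N') V t, hf⟩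
    · rintro ⟨a, rfl⟩
      refine sec_ext _ _ _ fun p hp => ?_
      obtain ⟨V, hV, hpV, t, ht⟩ := quot_local N' a p hp
      refine ⟨V, hV, hpV, ?_⟩
      rw [← ap_res, ← ap_res, ← ht, quotMap_proj, quotMap_proj, map_one, quotProj_eq_one]
      exact (hP V _).2 ⟨t, rfl⟩
  · intro U c p hp
    obtain ⟨V, hV, hpV, t, ht⟩ := quot_local P c p hp
    exact ⟨V, hV, hpV, ap (quotProj N) V t, ht⟩

/-! ### Čech cohomology in degrees zero and one -/

/-- The global sections `H⁰(X, F)`. -/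
abbrev H0 (F : GrpSheaf X) : Type u := Sec F ⊤

/-- An open covering of `X`, indexed by the points of `X` in such a way that the set with index `x`
contains `x`. Every open covering has a refinement of this form. -/
structure Covering (X : TopCat.{u}) where
  set : X → Opens X
  mem : ∀ x, x ∈ set x

/-- Cocycles on the coverings of `X`. -/
structure Torsor (F : GrpSheaf X) where
  cov : Covering X
  cocycle : PresheafOfGroups.OneCocycle F.obj cov.set

/-- The restriction of a cocycle to a smaller family of open sets. -/
def refine {F : GrpSheaf X} {𝒰 𝒱 : X → Opens X} (h : ∀ x, 𝒱 x ≤ 𝒰 x)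
    (γ : PresheafOfGroups.OneCocycle F.obj 𝒰) : PresheafOfGroups.OneCocycle F.obj 𝒱 where
  ev x y _ a b := γ.ev x y (a ≫ homOfLE (h x)) (b ≫ homOfLE (h y))
  ev_precomp x y _ _ φ a b := by simp [Category.assoc]
  ev_trans x y z _ a b c := γ.ev_trans x y z _ _ _

/-- The value of a cocycle over an open set. -/
def val {F : GrpSheaf X} {𝒰 : X → Opens X} (γ : PresheafOfGroups.OneCocycle F.obj 𝒰) (x y : X)
    {V : Opens X} (hx : V ≤ 𝒰 x) (hy : V ≤ 𝒰 y) : Sec F V :=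
  γ.ev x y (homOfLE hx) (homOfLE hy)

lemma val_res {F : GrpSheaf X} {𝒰 : X → Opens X} (γ : PresheafOfGroups.OneCocycle F.obj 𝒰)
    (x y : X) {V W : Opens X} (hx : V ≤ 𝒰 x) (hy : V ≤ 𝒰 y) (h : W ≤ V) :
    res F h (val γ x y hx hy) = val γ x y (h.trans hx) (h.trans hy) :=
  γ.ev_precomp x y (homOfLE h) _ _

lemma val_trans {F : GrpSheaf X} {𝒰 : X → Opens X} (γ : PresheafOfGroups.OneCocycle F.obj 𝒰)
    (x y z : X) {V : Opens X} (hx : V ≤ 𝒰 x) (hy : V ≤ 𝒰 y) (hz : V ≤ 𝒰 z) :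
    val γ x y hx hy * val γ y z hy hz = val γ x z hx hz :=
  γ.ev_trans x y z _ _ _

lemma val_self {F : GrpSheaf X} {𝒰 : X → Opens X} (γ : PresheafOfGroups.OneCocycle F.obj 𝒰)
    (x : X) {V : Opens X} (hx : V ≤ 𝒰 x) : val γ x x hx hx = 1 :=
  PresheafOfGroups.OneCocycle.ev_refl F.obj 𝒰 γ x _

lemma val_refine {F : GrpSheaf X} {𝒰 𝒱 : X → Opens X} (h : ∀ x, 𝒱 x ≤ 𝒰 x)
    (γ : PresheafOfGroups.OneCocycle F.obj 𝒰) (x y : X) {V : Opens X} (hx : V ≤ 𝒱 x)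
    (hy : V ≤ 𝒱 y) :
    val (refine h γ) x y hx hy = val γ x y (hx.trans (h x)) (hy.trans (h y)) := rfl

/-- The cocycle given by sections over the sets `𝒰 x ⊓ 𝒰 y`. -/
def mkCocycle {F : GrpSheaf X} (𝒰 : X → Opens X) (g : ∀ x y, Sec F (𝒰 x ⊓ 𝒰 y))
    (h : ∀ x y z (V : Opens X) (hx : V ≤ 𝒰 x) (hy : V ≤ 𝒰 y) (hz : V ≤ 𝒰 z),
      res F (le_inf hx hy) (g x y) * res F (le_inf hy hz) (g y z) = res F (le_inf hx hz) (g x z)) :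
    PresheafOfGroups.OneCocycle F.obj 𝒰 where
  ev x y _ a b := res F (le_inf a.le b.le) (g x y)
  ev_precomp x y _ _ φ _ _ := res_res F _ φ.le (g x y)
  ev_trans x y z V a b c := h x y z V a.le b.le c.le

lemma val_mk {F : GrpSheaf X} (𝒰 : X → Opens X) (g : ∀ x y, Sec F (𝒰 x ⊓ 𝒰 y)) (h)
    (x y : X) {V : Opens X} (hx : V ≤ 𝒰 x) (hy : V ≤ 𝒰 y) :
    val (mkCocycle 𝒰 g h) x y hx hy = res F (le_inf hx hy) (g x y) := rfl

/-- Two cocycles are cohomologous if they are so on a common refinement of their coverings. -/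
def Torsor.Rel {F : GrpSheaf X} (γ γ' : Torsor F) : Prop :=
  ∃ (𝒲 : Covering X) (h : ∀ x, 𝒲.set x ≤ γ.cov.set x) (h' : ∀ x, 𝒲.set x ≤ γ'.cov.set x),
    (refine h γ.cocycle).IsCohomologous (refine h' γ'.cocycle)

lemma isCohomologous_iff {F : GrpSheaf X} {𝒰 : X → Opens X}
    (γ γ' : PresheafOfGroups.OneCocycle F.obj 𝒰) :
    γ.IsCohomologous γ' ↔ ∃ f : ∀ x, Sec F (𝒰 x), ∀ x y (V : Opens X) (hx : V ≤ 𝒰 x)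
      (hy : V ≤ 𝒰 y), res F hx (f x) * val γ x y hx hy = val γ' x y hx hy * res F hy (f y) :=
  ⟨fun ⟨f, hf⟩ => ⟨f, fun x y _ hx hy => hf x y (homOfLE hx) (homOfLE hy)⟩,
    fun ⟨f, hf⟩ => ⟨f, fun x y _ a b => hf x y _ a.le b.le⟩⟩

lemma Torsor.rel_iff {F : GrpSheaf X} (γ γ' : Torsor F) : γ.Rel γ' ↔
    ∃ (𝒲 : Covering X) (h : ∀ x, 𝒲.set x ≤ γ.cov.set x) (h' : ∀ x, 𝒲.set x ≤ γ'.cov.set x)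
      (f : ∀ x, Sec F (𝒲.set x)), ∀ x y (V : Opens X) (hx : V ≤ 𝒲.set x) (hy : V ≤ 𝒲.set y),
      res F hx (f x) * val γ.cocycle x y (hx.trans (h x)) (hy.trans (h y)) =
        val γ'.cocycle x y (hx.trans (h' x)) (hy.trans (h' y)) * res F hy (f y) := by
  unfold Torsor.Rel
  simp only [isCohomologous_iff, val_refine]

/-- The intersection of two coverings. -/
def Covering.inf (𝒰 𝒱 : Covering X) : Covering X := ⟨fun x => 𝒰.set x ⊓ 𝒱.set x, fun x =>
  ⟨𝒰.mem x, 𝒱.mem x⟩⟩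

lemma Covering.inf_l (𝒰 𝒱 : Covering X) (x : X) : (𝒰.inf 𝒱).set x ≤ 𝒰.set x := inf_le_left

lemma Covering.inf_r (𝒰 𝒱 : Covering X) (x : X) : (𝒰.inf 𝒱).set x ≤ 𝒱.set x := inf_le_right

lemma Torsor.rel_equivalence (F : GrpSheaf X) : Equivalence (Torsor.Rel (F := F)) where
  refl γ := ⟨γ.cov, fun _ => le_rfl, fun _ => le_rfl,
    (PresheafOfGroups.OneCocycle.equivalence_isCohomologous _ _).refl _⟩
  symm := fun ⟨𝒲, h, h', e⟩ => ⟨𝒲, h', h,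
    (PresheafOfGroups.OneCocycle.equivalence_isCohomologous _ _).symm e⟩
  trans := by
    intro γ₁ γ₂ γ₃ h₁₂ h₂₃
    rw [Torsor.rel_iff] at *
    obtain ⟨𝒰, h₁, h₂, f, hf⟩ := h₁₂
    obtain ⟨𝒱, h₂', h₃, g, hg⟩ := h₂₃
    refine ⟨𝒰.inf 𝒱, fun x => (𝒰.inf_l 𝒱 x).trans (h₁ x), fun x => (𝒰.inf_r 𝒱 x).trans (h₃ x),
      fun x => res F (𝒰.inf_r 𝒱 x) (g x) * res F (𝒰.inf_l 𝒱 x) (f x), ?_⟩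
    intro x y V hx hy
    have e₁ := hf x y V (hx.trans (𝒰.inf_l 𝒱 x)) (hy.trans (𝒰.inf_l 𝒱 y))
    have e₂ := hg x y V (hx.trans (𝒰.inf_r 𝒱 x)) (hy.trans (𝒰.inf_r 𝒱 y))
    rw [map_mul, map_mul, res_res, res_res, res_res, res_res, mul_assoc, e₁, ← mul_assoc, e₂,
      mul_assoc]

/-- The setoid of cohomologous cocycles. -/
def torsorSetoid (F : GrpSheaf X) : Setoid (Torsor F) := ⟨Torsor.Rel, Torsor.rel_equivalence F⟩

/-- The Čech cohomology set `Ȟ¹(X, F)`: cocycles on open coverings, up to refinement and up to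
cohomologous cocycles. It is the set of isomorphism classes of `F`-torsors. -/
def H1 (F : GrpSheaf X) : Type u := Quotient (torsorSetoid F)

/-- The class of a cocycle. -/
def Torsor.cls {F : GrpSheaf X} (γ : Torsor F) : H1 F := Quotient.mk (torsorSetoid F) γ

/-- The class of the trivial torsor. -/
instance (F : GrpSheaf X) : One (H1 F) := ⟨Torsor.cls ⟨⟨fun _ => ⊤, fun _ => trivial⟩, 1⟩⟩

/-- The image of a cocycle under a morphism of sheaves of groups. -/
def mapCocycle {F G : GrpSheaf X} (f : F ⟶ G) {𝒰 : X → Opens X}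
    (γ : PresheafOfGroups.OneCocycle F.obj 𝒰) : PresheafOfGroups.OneCocycle G.obj 𝒰 where
  ev x y V a b := ap f V (γ.ev x y a b)
  ev_precomp x y V W φ a b := by
    rw [← γ.ev_precomp x y φ a b]
    exact (ap_res f φ.le (γ.ev x y a b)).symm
  ev_trans x y z V a b c := by rw [← γ.ev_trans x y z a b c, map_mul]

lemma val_map {F G : GrpSheaf X} (f : F ⟶ G) {𝒰 : X → Opens X}
    (γ : PresheafOfGroups.OneCocycle F.obj 𝒰) (x y : X) {V : Opens X} (hx : V ≤ 𝒰 x)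
    (hy : V ≤ 𝒰 y) : val (mapCocycle f γ) x y hx hy = ap f V (val γ x y hx hy) := rfl

/-- The image of a torsor under a morphism of sheaves of groups. -/
def Torsor.map {F G : GrpSheaf X} (f : F ⟶ G) (γ : Torsor F) : Torsor G :=
  ⟨γ.cov, mapCocycle f γ.cocycle⟩

/-- The map `Ȟ¹(X, F) → Ȟ¹(X, G)` induced by a morphism of sheaves of groups. -/
def H1.map {F G : GrpSheaf X} (f : F ⟶ G) : H1 F → H1 G :=
  Quotient.lift (fun γ => (γ.map f).cls) (by
    intro γ γ' h
    refine Quotient.sound ?_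
    obtain ⟨𝒲, h, h', g, hg⟩ := (Torsor.rel_iff γ γ').1 h
    refine (Torsor.rel_iff _ _).2 ⟨𝒲, h, h', fun x => ap f _ (g x), fun x y V hx hy => ?_⟩
    have := congrArg (ap f V) (hg x y V hx hy)
    rw [map_mul, map_mul, ap_res, ap_res] at this
    exact this)

lemma H1.map_cls {F G : GrpSheaf X} (f : F ⟶ G) (γ : Torsor F) :
    H1.map f γ.cls = (γ.map f).cls := rfl

/-! ### The connecting map in degree zero -/

/-- `a` is the class of the cocycle `b x * (b y)⁻¹`, for local lifts `b x` of the section `c`. -/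
def IsConnecting {A B C : GrpSheaf X} (i : A ⟶ B) (π : B ⟶ C) (c : H0 C) (a : H1 A) : Prop :=
  ∃ (γ : Torsor A) (b : ∀ x, Sec B (γ.cov.set x)), γ.cls = a ∧
    (∀ x, ap π _ (b x) = res C le_top c) ∧
    ∀ x y (V : Opens X) (hx : V ≤ γ.cov.set x) (hy : V ≤ γ.cov.set y),
      ap i V (val γ.cocycle x y hx hy) = res B hx (b x) * (res B hy (b y))⁻¹

lemma IsShortExact.exists_connecting {A B C : GrpSheaf X} {i : A ⟶ B} {π : B ⟶ C}
    (h : IsShortExact i π) (c : H0 C) : ∃ a, IsConnecting i π c a := by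
  have hs := fun x : X => h.surj ⊤ c x trivial
  choose U hU hx b hb using hs
  have ha : ∀ x y, ∃ a : Sec A (U x ⊓ U y),
      ap i _ a = res B inf_le_left (b x) * (res B inf_le_right (b y))⁻¹ := by
    intro x y
    rw [← h.exact, map_mul, map_inv, ap_res, ap_res, hb, hb, res_res, res_res, mul_inv_cancel]
  choose a ha using ha
  have hc : ∀ x y z (V : Opens X) (hx : V ≤ U x) (hy : V ≤ U y) (hz : V ≤ U z),
      res A (le_inf hx hy) (a x y) * res A (le_inf hy hz) (a y z) =
        res A (le_inf hx hz) (a x z) := by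
    intro x y z V hx hy hz
    apply h.inj
    rw [map_mul, ap_res, ap_res, ap_res, ha, ha, ha]
    simp only [map_mul, map_inv, res_res]
    group
  refine ⟨Torsor.cls ⟨⟨U, hx⟩, mkCocycle U a hc⟩, ⟨⟨U, hx⟩, mkCocycle U a hc⟩, b, rfl, hb, ?_⟩
  intro x y V hx hy
  rw [val_mk]
  rw [ap_res, ha, map_mul, map_inv, res_res, res_res]

lemma IsShortExact.connecting_unique {A B C : GrpSheaf X} {i : A ⟶ B} {π : B ⟶ C}
    (h : IsShortExact i π) {c : H0 C} {a a' : H1 A} (ha : IsConnecting i π c a)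
    (ha' : IsConnecting i π c a') : a = a' := by
  obtain ⟨γ, b, rfl, hb, hγ⟩ := ha
  obtain ⟨γ', b', rfl, hb', hγ'⟩ := ha'
  refine Quotient.sound ((Torsor.rel_iff _ _).2 ?_)
  have hf : ∀ x, ∃ f : Sec A ((γ.cov.inf γ'.cov).set x),
      ap i _ f = res B (γ.cov.inf_r γ'.cov x) (b' x) * (res B (γ.cov.inf_l γ'.cov x) (b x))⁻¹ := by
    intro x
    rw [← h.exact, map_mul, map_inv, ap_res, ap_res, hb, hb', res_res, res_res, mul_inv_cancel]
  choose f hf using hf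
  refine ⟨γ.cov.inf γ'.cov, γ.cov.inf_l γ'.cov, γ.cov.inf_r γ'.cov, f, ?_⟩
  intro x y V hx hy
  apply h.inj
  rw [map_mul, map_mul, ap_res, ap_res, hf, hf, hγ, hγ']
  simp only [map_mul, map_inv, res_res]
  group

/-- The connecting map `δ¹ : H⁰(X, C) → Ȟ¹(X, A)` of a short exact sequence
`1 ⟶ A ⟶ B ⟶ C ⟶ 1` of sheaves of groups. -/
def delta1 {A B C : GrpSheaf X} {i : A ⟶ B} {π : B ⟶ C} (h : IsShortExact i π) (c : H0 C) : H1 A :=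
  (h.exists_connecting c).choose

lemma delta1_eq_iff {A B C : GrpSheaf X} {i : A ⟶ B} {π : B ⟶ C} (h : IsShortExact i π)
    (c : H0 C) (a : H1 A) : delta1 h c = a ↔ IsConnecting i π c a :=
  ⟨fun e => e ▸ (h.exists_connecting c).choose_spec,
    fun e => h.connecting_unique (h.exists_connecting c).choose_spec e⟩

lemma delta1_eq_delta1 {A B C : GrpSheaf X} {i : A ⟶ B} {π : B ⟶ C} (h : IsShortExact i π)
    {c c' : H0 C} (e : delta1 h c = delta1 h c') : ∃ b, ap π ⊤ b = c⁻¹ * c' := by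
  obtain ⟨γ, b, hγc, hb, hγ⟩ := (delta1_eq_iff h c _).1 rfl
  obtain ⟨γ', b', hγc', hb', hγ'⟩ := (delta1_eq_iff h c' _).1 rfl
  obtain ⟨𝒲, h₁, h₂, f, hf⟩ := (Torsor.rel_iff γ γ').1 (Quotient.exact (hγc.trans (e.trans hγc'.symm)))
  obtain ⟨t, ht⟩ := sec_glue B (U := ⊤) (fun p => 𝒲.set p.1) (fun _ => le_top)
    (fun p => 𝒲.mem p.1)
    (fun p => (res B (h₁ p.1) (b p.1))⁻¹ * (ap i _ (f p.1))⁻¹ * res B (h₂ p.1) (b' p.1)) (by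
      intro p q
      have := congrArg (ap i _) (hf p.1 q.1 _ (inf_le_left : 𝒲.set p.1 ⊓ 𝒲.set q.1 ≤ _) inf_le_right)
      rw [map_mul, map_mul, hγ, hγ', ap_res, ap_res] at this
      simp only [map_mul, map_inv, res_res]
      have e' := congrArg (fun z => (res B (inf_le_left.trans (h₁ p.1)) (b p.1))⁻¹ *
        (res B inf_le_left (ap i (𝒲.set p.1) (f p.1)))⁻¹ * z * (res B inf_le_right
          (ap i (𝒲.set q.1) (f q.1)))⁻¹ *
        res B (inf_le_right.trans (h₂ q.1)) (b' q.1)) this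
      simp only [mul_assoc, inv_mul_cancel_left, mul_inv_cancel_left, inv_mul_cancel, mul_one] at e'
      rw [mul_assoc, mul_assoc, e'])
  refine ⟨t, sec_ext C _ _ fun p _ => ⟨𝒲.set p, le_top, 𝒲.mem p, ?_⟩⟩
  have hi : ap π _ (ap i _ (f p)) = 1 := (h.exact _ _).2 ⟨_, rfl⟩
  rw [← ap_res, ht ⟨p, trivial⟩, map_mul, map_mul, map_inv, map_inv, ap_res, ap_res, hb, hb', hi,
    res_res, res_res, map_mul, map_inv, inv_one, mul_one]

/-! ### The sheaf of discontinuous sections -/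

/-- The subsheaf of sections mapped into a given subsheaf by a morphism. -/
def SubgrpSheaf.comap {F G : GrpSheaf X} (f : F ⟶ G) (N : SubgrpSheaf G) : SubgrpSheaf F where
  sec U := (N.sec U).comap (ap f U)
  res_mem h s hs := by
    rw [Subgroup.mem_comap, ap_res]
    exact N.res_mem h hs
  local_mem s hs := N.local_mem _ fun p hp => by
    obtain ⟨V, hV, hpV, h⟩ := hs p hp
    rw [Subgroup.mem_comap, ap_res] at h
    exact ⟨V, hV, hpV, h⟩

instance {F G : GrpSheaf X} (f : F ⟶ G) (N : SubgrpSheaf G) [hN : N.Normal] :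
    (N.comap f).Normal where
  normal U := (hN.normal U).comap (ap f U)

/-- The image of a monomorphism. -/
def SubgrpSheaf.range {A B : GrpSheaf X} (i : A ⟶ B) (hi : ∀ U, Function.Injective (ap i U)) :
    SubgrpSheaf B where
  sec U := (ap i U).range
  res_mem := by
    rintro U V h _ ⟨a, rfl⟩
    exact ⟨res A h a, ap_res i h a⟩
  local_mem s hs := mem_range_of_local i hi s hs

/-- The factorisation of a morphism through a monomorphism. -/
def factor {A B F : GrpSheaf X} (i : A ⟶ B) (hi : ∀ U, Function.Injective (ap i U)) (f : F ⟶ B)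
    (h : ∀ U s, ap f U s ∈ (ap i U).range) : F ⟶ A :=
  ⟨{ app := fun U => GrpCat.ofHom ((MonoidHom.ofInjective (hi U.unop)).symm.toMonoidHom.comp
        ((ap f U.unop).codRestrict _ (h U.unop)))
     naturality := by
        intro U V g
        ext s
        have hs : ∀ (W : Opens X) (t : Sec F W), ap i W ((MonoidHom.ofInjective (hi W)).symm
            ⟨ap f W t, h W t⟩) = ap f W t := fun W t =>
          MonoidHom.apply_ofInjective_symm (hi W) ⟨ap f W t, h W t⟩
        refine hi V.unop ((hs V.unop (res F g.unop.le s)).trans ?_)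
        refine Eq.trans ?_ (ap_res i g.unop.le ((MonoidHom.ofInjective (hi U.unop)).symm
            ⟨ap f U.unop s, h U.unop s⟩)).symm
        rw [hs, ap_res] }⟩

lemma ap_factor {A B F : GrpSheaf X} (i : A ⟶ B) (hi : ∀ U, Function.Injective (ap i U))
    (f : F ⟶ B) (h : ∀ U s, ap f U s ∈ (ap i U).range) {U : Opens X} (s : Sec F U) :
    ap i U (ap (factor i hi f h) U s) = ap f U s :=
  MonoidHom.apply_ofInjective_symm (hi U) ⟨ap f U s, h U s⟩

lemma ap_comp {F G K : GrpSheaf X} (f : F ⟶ G) (g : G ⟶ K) {U : Opens X} (s : Sec F U) :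
    ap (f ≫ g) U s = ap g U (ap f U s) := rfl

lemma incl_injective {F : GrpSheaf X} (H : SubgrpSheaf F) (U : Opens X) :
    Function.Injective (ap H.incl U) := Subtype.val_injective

/-- The sheaf of not necessarily continuous sections of `F`: its sections over `U` are the families
of elements of the stalks of `F` at the points of `U`. -/
def god (F : GrpSheaf X) : GrpSheaf X := piSheaf (Stalk F)

/-- The value of a discontinuous section at a point. -/
def at' {F : GrpSheaf X} {U : Opens X} (p : X) (hp : p ∈ U) : Sec (god F) U →* Stalk F p :=
  Pi.evalMonoidHom (fun p : U => Stalk F p.1) ⟨p, hp⟩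

/-- The discontinuous section with given values. -/
def mkGod {F : GrpSheaf X} {U : Opens X} (s : ∀ p ∈ U, Stalk F p) : Sec (god F) U :=
  show ∀ p : U, Stalk F p.1 from fun p => s p.1 p.2

lemma at'_mk {F : GrpSheaf X} {U : Opens X} (s : ∀ p ∈ U, Stalk F p) (p : X) (hp : p ∈ U) :
    at' p hp (mkGod s) = s p hp := rfl

lemma god_ext {F : GrpSheaf X} {U : Opens X} {s t : Sec (god F) U}
    (h : ∀ p hp, at' p hp s = at' p hp t) : s = t := funext fun p : U => h p.1 p.2

lemma at'_res {F : GrpSheaf X} {U V : Opens X} (h : V ≤ U) (s : Sec (god F) U) (p : X)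
    (hp : p ∈ V) : at' p hp (res (god F) h s) = at' p (h hp) s := rfl

/-- The inclusion of `F` in the sheaf of its discontinuous sections. -/
def godUnit (F : GrpSheaf X) : F ⟶ god F := toPi fun p => MonoidHom.id (Stalk F p)

lemma at'_unit {F : GrpSheaf X} {U : Opens X} (s : Sec F U) (p : X) (hp : p ∈ U) :
    at' p hp (ap (godUnit F) U s) = germ F p hp s := rfl

lemma godUnit_injective (F : GrpSheaf X) (U : Opens X) : Function.Injective (ap (godUnit F) U) := by
  intro s t h
  refine sec_ext_germ F s t fun p hp => ?_
  rw [← at'_unit, h, at'_unit]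

/-- The morphism induced on discontinuous sections. -/
def godMap {F G : GrpSheaf X} (f : F ⟶ G) : god F ⟶ god G :=
  ⟨{ app := fun U => GrpCat.ofHom (Y := (∀ p : U.unop, Stalk G p.1))
        (MonoidHom.pi fun p : U.unop => (stalkMap f p.1).comp
          (Pi.evalMonoidHom (fun p : U.unop => Stalk F p.1) p))
     naturality := fun _ _ _ => rfl }⟩

lemma at'_map {F G : GrpSheaf X} (f : F ⟶ G) {U : Opens X} (s : Sec (god F) U) (p : X)
    (hp : p ∈ U) : at' p hp (ap (godMap f) U s) = stalkMap f p (at' p hp s) := rfl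

/-! ### Commutative sheaves of groups as abelian sheaves -/

/-- Commutativity of a sheaf of groups. -/
def IsComm (F : GrpSheaf X) : Prop := ∀ U (a b : Sec F U), a * b = b * a

/-- The sections of a commutative sheaf of groups, written additively. -/
def AbSec (F : GrpSheaf X) (_ : IsComm F) (U : Opens X) : Type u := Additive (Sec F U)

instance (F : GrpSheaf X) (hF : IsComm F) (U : Opens X) : AddCommGroup (AbSec F hF U) :=
  @Additive.addCommGroup _ { (inferInstance : Group (Sec F U)) with mul_comm := hF U }

/-- A homomorphism between groups of sections, written additively. -/
def abHom {F G : GrpSheaf X} (hF : IsComm F) (hG : IsComm G) {U V : Opens X}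
    (f : Sec F U →* Sec G V) : AbSec F hF U →+ AbSec G hG V where
  toFun s := Additive.ofMul (f (Additive.toMul s))
  map_zero' := f.map_one
  map_add' s t := f.map_mul (Additive.toMul s) (Additive.toMul t)

/-- A commutative sheaf of groups, as an abelian sheaf (written additively). -/
def ab (F : GrpSheaf X) (hF : IsComm F) : AbSheaf X where
  obj :=
    { obj U := AddCommGrpCat.of (AbSec F hF U.unop)
      map f := AddCommGrpCat.ofHom (abHom hF hF (res F f.unop.le))
      map_id U := by
        ext s
        exact res_self F (Additive.toMul s)
      map_comp f g := by
        ext s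
        exact (res_res F f.unop.le g.unop.le (Additive.toMul s)).symm }
  property := (TopCat.Presheaf.isSheaf_iff_isSheafUniqueGluing (C := AddCommGrpCat.{u}) _).mpr
    fun _ U s h => TopCat.Sheaf.existsUnique_gluing (C := GrpCat.{u}) F U
      (fun i => (show Sec F (U i) from s i)) h

/-- A morphism of commutative sheaves of groups, as a morphism of abelian sheaves. -/
def abMap {F G : GrpSheaf X} (f : F ⟶ G) (hF : IsComm F) (hG : IsComm G) : ab F hF ⟶ ab G hG :=
  ⟨{ app := fun U => AddCommGrpCat.ofHom (abHom hF hG (ap f U.unop))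
     naturality := by
        intro U V g
        ext s
        exact ap_res f g.unop.le (Additive.toMul s) }⟩

/-- A short exact sequence of commutative sheaves of groups, in the category of abelian sheaves. -/
abbrev abComplex {A B C : GrpSheaf X} {i : A ⟶ B} {π : B ⟶ C} (h : IsShortExact i π)
    (hA : IsComm A) (hB : IsComm B) (hC : IsComm C) : ShortComplex (AbSheaf X) :=
  ShortComplex.mk (abMap i hA hB) (abMap π hB hC) (by
    ext U s
    exact (h.exact _ _).2 ⟨Additive.toMul (show AbSec A hA U.unop from s), rfl⟩)

lemma abComplex_shortExact {A B C : GrpSheaf X} {i : A ⟶ B} {π : B ⟶ C} (h : IsShortExact i π)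
    (hA : IsComm A) (hB : IsComm B) (hC : IsComm C) : (abComplex h hA hB hC).ShortExact := by
  have inj : ∀ U, Function.Injective ((abMap i hA hB).hom.app (op U)).hom := fun U => h.inj U
  have mono : Mono (abMap i hA hB) := Sheaf.mono_of_injective _ (fun U => inj U.unop)
  have epi : Epi (abMap π hB hC) := by
    have : Sheaf.IsLocallySurjective (abMap π hB hC) := by
      refine (TopCat.Presheaf.isLocallySurjective_iff (abMap π hB hC).hom).mpr ?_
      intro U c p hp
      obtain ⟨V, hV, hpV, b, hb⟩ := h.surj U (Additive.toMul (show AbSec C hC U from c)) p hp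
      exact ⟨V, hV, ⟨show AbSec B hB V from Additive.ofMul b, hb⟩, hpV⟩
    infer_instance
  refine { mono_f := mono, epi_g := epi, exact := ?_ }
  rw [ShortComplex.exact_iff_exact_up_to_refinements]
  intro W f hf
  have hex : ∀ (U : (Opens X)ᵒᵖ) (s : W.obj.obj U),
      ((f.hom.app U).hom s) ∈ ((abMap i hA hB).hom.app U).hom.range := by
    intro U s
    have h0 : ((abMap π hB hC).hom.app U).hom ((f.hom.app U).hom s) = 0 := by
      have := congrArg (fun g => (g.hom.app U).hom s) hf
      exact this
    obtain ⟨a, ha⟩ := (h.exact U.unop _).1 h0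
    exact ⟨show AbSec A hA U.unop from Additive.ofMul a, ha⟩
  let g : W ⟶ ab A hA :=
    ⟨{ app := fun U => AddCommGrpCat.ofHom
        ((AddMonoidHom.ofInjective (inj U.unop)).symm.toAddMonoidHom.comp
          ((f.hom.app U).hom.codRestrict _ (hex U)))
       naturality := by
        intro U V r
        ext s
        have hs : ∀ (U : (Opens X)ᵒᵖ) (t : W.obj.obj U), ((abMap i hA hB).hom.app U).hom
            ((AddMonoidHom.ofInjective (inj U.unop)).symm ⟨(f.hom.app U).hom t, hex U t⟩) =
              (f.hom.app U).hom t := fun U t =>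
          AddMonoidHom.apply_ofInjective_symm (inj U.unop) ⟨(f.hom.app U).hom t, hex U t⟩
        refine inj V.unop ((hs V ((W.obj.map r).hom s)).trans ?_)
        refine (ConcreteCategory.congr_hom (f.hom.naturality r) s).trans ?_
        refine Eq.trans ?_ (ConcreteCategory.congr_hom ((abMap i hA hB).hom.naturality r)
          ((AddMonoidHom.ofInjective (inj U.unop)).symm ⟨(f.hom.app U).hom s, hex U s⟩)).symm
        exact congrArg ((ab B hB).obj.map r).hom (hs U s).symm }⟩
  refine ⟨W, 𝟙 W, inferInstance, g, ?_⟩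
  ext U s
  exact (AddMonoidHom.apply_ofInjective_symm (inj U.unop) ⟨(f.hom.app U).hom s, hex U s⟩).symm

/-! ### The connecting map in degree one of a central extension -/

/-- Exactness of `1 ⟶ A ⟶ B ⟶ C ⟶ 1`, with `A` contained in the centre of `B`. -/
structure IsCentralExt {A B C : GrpSheaf X} (i : A ⟶ B) (π : B ⟶ C) : Prop
    extends IsShortExact i π where
  central : ∀ U (a : Sec A U) (b : Sec B U), ap i U a * b = b * ap i U a

section Stalks

variable {A B C : GrpSheaf X} {i : A ⟶ B} {π : B ⟶ C}

lemma mem_inf {U V : Opens X} {p : X} (hU : p ∈ U) (hV : p ∈ V) : p ∈ U ⊓ V := ⟨hU, hV⟩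

lemma IsCentralExt.comm (h : IsCentralExt i π) : IsComm A := fun U a b =>
  h.inj U (by rw [map_mul, map_mul, h.central])

lemma IsShortExact.stalk_inj (h : IsShortExact i π) (p : X) :
    Function.Injective (stalkMap i p) := by
  rw [injective_iff_map_eq_one]
  intro z hz
  obtain ⟨U, hp, a, rfl⟩ := exists_germ A z
  rw [stalkMap_germ, ← map_one (germ B p hp)] at hz
  obtain ⟨W, h₁, h₂, hW, e⟩ := germ_eq B hp hp _ _ hz
  rw [← ap_res, map_one, ← map_one (ap i W)] at e
  rw [← germ_res A h₁ p hW, h.inj W e, map_one]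

lemma IsShortExact.stalk_exact (h : IsShortExact i π) (p : X) (z : Stalk B p)
    (hz : stalkMap π p z = 1) : ∃ w, stalkMap i p w = z := by
  obtain ⟨U, hp, b, rfl⟩ := exists_germ B z
  rw [stalkMap_germ, ← map_one (germ C p hp)] at hz
  obtain ⟨W, h₁, h₂, hW, e⟩ := germ_eq C hp hp _ _ hz
  rw [← ap_res, map_one] at e
  obtain ⟨a, ha⟩ := (h.exact W _).1 e
  exact ⟨germ A p hW a, by rw [stalkMap_germ, ha, germ_res]⟩

lemma IsShortExact.stalk_comp (h : IsShortExact i π) (p : X) (w : Stalk A p) :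
    stalkMap π p (stalkMap i p w) = 1 := by
  obtain ⟨U, hp, a, rfl⟩ := exists_germ A w
  rw [stalkMap_germ, stalkMap_germ, (h.exact U _).2 ⟨a, rfl⟩, map_one]

lemma IsShortExact.stalk_surj (h : IsShortExact i π) (p : X) :
    Function.Surjective (stalkMap π p) := by
  intro z
  obtain ⟨U, hp, c, rfl⟩ := exists_germ C z
  obtain ⟨V, hV, hpV, b, hb⟩ := h.surj U c p hp
  exact ⟨germ B p hpV b, by rw [stalkMap_germ, hb, germ_res]⟩

lemma IsCentralExt.stalk_central (h : IsCentralExt i π) (p : X) (w : Stalk A p) (z : Stalk B p) :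
    stalkMap i p w * z = z * stalkMap i p w := by
  obtain ⟨U, hU, a, rfl⟩ := exists_germ A w
  obtain ⟨V, hV, b, rfl⟩ := exists_germ B z
  have hp : p ∈ U ⊓ V := ⟨hU, hV⟩
  rw [← germ_res A inf_le_left p hp a, ← germ_res B inf_le_right p hp b, stalkMap_germ, ← map_mul,
    ← map_mul, h.central]

end Stalks

lemma IsComm.stalk {F : GrpSheaf X} (hF : IsComm F) (p : X) (z w : Stalk F p) :
    z * w = w * z := by
  obtain ⟨U, hU, a, rfl⟩ := exists_germ F z
  obtain ⟨V, hV, b, rfl⟩ := exists_germ F w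
  have hp : p ∈ U ⊓ V := ⟨hU, hV⟩
  rw [← germ_res F inf_le_left p hp a, ← germ_res F inf_le_right p hp b, ← map_mul, ← map_mul,
    hF]

lemma IsComm.god {F : GrpSheaf X} (hF : IsComm F) : IsComm (god F) := fun U a b =>
  god_ext fun p hp => by rw [map_mul, map_mul, hF.stalk]

lemma IsComm.normal {F : GrpSheaf X} (hF : IsComm F) (N : SubgrpSheaf F) : N.Normal where
  normal U := ⟨fun n hn g => by rwa [hF U g n, mul_inv_cancel_right]⟩

lemma IsShortExact.comm {A B C : GrpSheaf X} {i : A ⟶ B} {π : B ⟶ C} (h : IsShortExact i π)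
    (hB : IsComm B) : IsComm C := by
  intro U a b
  refine sec_ext C _ _ fun p hp => ?_
  obtain ⟨V, hV, hpV, s, hs⟩ := h.surj U a p hp
  obtain ⟨W, hW, hpW, t, ht⟩ := h.surj V (res C hV b) p hpV
  refine ⟨W, hW.trans hV, hpW, ?_⟩
  rw [map_mul, map_mul, ← res_res C hV hW a, ← res_res C hV hW b, ← hs, ← ht, ← ap_res, ← map_mul,
    ← map_mul, hB]

/-- The quotient of a commutative sheaf `G` by the image of a monomorphism `i : F ⟶ G`. -/
def coker {F G : GrpSheaf X} (i : F ⟶ G) (hi : ∀ U, Function.Injective (ap i U)) (hG : IsComm G) :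
    GrpSheaf X :=
  haveI := hG.normal (SubgrpSheaf.range i hi)
  quot (SubgrpSheaf.range i hi)

/-- The projection onto the cokernel. -/
def cokerProj {F G : GrpSheaf X} (i : F ⟶ G) (hi : ∀ U, Function.Injective (ap i U))
    (hG : IsComm G) : G ⟶ coker i hi hG :=
  haveI := hG.normal (SubgrpSheaf.range i hi)
  quotProj (SubgrpSheaf.range i hi)

lemma coker_shortExact {F G : GrpSheaf X} (i : F ⟶ G) (hi : ∀ U, Function.Injective (ap i U))
    (hG : IsComm G) : IsShortExact i (cokerProj i hi hG) := by
  have := hG.normal (SubgrpSheaf.range i hi)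
  refine ⟨hi, fun U b => quotProj_eq_one (SubgrpSheaf.range i hi) b, fun U c p hp => ?_⟩
  exact quot_local (SubgrpSheaf.range i hi) c p hp

section Ext

variable {A B C : GrpSheaf X} {i : A ⟶ B} {π : B ⟶ C}

/-- The discontinuous sections of `B` with continuous image in `C`. If `B` is a central extension
of `C` by `A`, this is the extension of `C` by the sheaf of discontinuous sections of `A` which is
deduced from it by pushing out along the inclusion of `A`. -/
def bigSub (π : B ⟶ C) : SubgrpSheaf (god B) :=
  (SubgrpSheaf.range (godUnit C) (godUnit_injective C)).comap (godMap π)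

/-- The subsheaf `bigSub`, as a sheaf. -/
abbrev big (π : B ⟶ C) : GrpSheaf X := (bigSub π).toSheaf

lemma big_mem (π : B ⟶ C) (U : Opens X) (s : Sec (big π) U) :
    ap ((bigSub π).incl ≫ godMap π) U s ∈ (ap (godUnit C) U).range := s.2

/-- The projection of `big π` to `C`. -/
def bigProj (π : B ⟶ C) : big π ⟶ C :=
  factor (godUnit C) (godUnit_injective C) ((bigSub π).incl ≫ godMap π) (big_mem π)

/-- The continuous sections in `big π`. -/
def bigCont (π : B ⟶ C) : SubgrpSheaf (big π) :=
  (SubgrpSheaf.range (godUnit B) (godUnit_injective B)).comap (bigSub π).incl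

/-- The value at a point of a section of `big π`. -/
def bv {U : Opens X} (p : X) (hp : p ∈ U) : Sec (big π) U →* Stalk B p :=
  (at' p hp).comp (ap (bigSub π).incl U)

lemma big_ext {U : Opens X} {s t : Sec (big π) U} (h : ∀ p hp, bv p hp s = bv p hp t) : s = t :=
  incl_injective _ U (god_ext h)

lemma bv_res {U V : Opens X} (h : V ≤ U) (s : Sec (big π) U) (p : X) (hp : p ∈ V) :
    bv p hp (res (big π) h s) = bv p (h hp) s := rfl

lemma germ_bigProj {U : Opens X} (s : Sec (big π) U) (p : X) (hp : p ∈ U) :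
    germ C p hp (ap (bigProj π) U s) = stalkMap π p (bv p hp s) := by
  rw [← at'_unit, bigProj, ap_factor]
  rfl

lemma exists_big {U : Opens X} (s : ∀ p ∈ U, Stalk B p) (c : Sec C U)
    (h : ∀ p hp, stalkMap π p (s p hp) = germ C p hp c) :
    ∃ e : Sec (big π) U, (∀ p hp, bv p hp e = s p hp) ∧ ap (bigProj π) U e = c := by
  have hm : mkGod s ∈ (bigSub π).sec U := ⟨c, god_ext fun p hp => (h p hp).symm⟩
  have he : ∃ e : Sec (big π) U, ∀ p hp, bv p hp e = s p hp := ⟨⟨mkGod s, hm⟩, fun _ _ => rfl⟩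
  obtain ⟨e, he⟩ := he
  refine ⟨e, he, sec_ext_germ C _ _ fun p hp => ?_⟩
  rw [germ_bigProj, he, h]

lemma mem_bigCont {U : Opens X} (s : Sec (big π) U) :
    s ∈ (bigCont π).sec U ↔ ∃ b : Sec B U, ∀ p hp, bv p hp s = germ B p hp b :=
  ⟨fun ⟨b, hb⟩ => ⟨b, fun p hp => congrArg (at' p hp) hb.symm⟩,
    fun ⟨b, hb⟩ => ⟨b, god_ext fun p hp => (hb p hp).symm⟩⟩

/-- Locally, a section of `big π` is a continuous section times a discontinuous section of `A`. -/
lemma IsShortExact.big_local (h : IsShortExact i π) {U : Opens X} (s : Sec (big π) U) (p : X)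
    (hp : p ∈ U) : ∃ (V : Opens X) (hV : V ≤ U), p ∈ V ∧ ∃ (b : Sec B V) (a : Sec (god A) V),
      ∀ q (hq : q ∈ V), bv q (hV hq) s = germ B q hq b * stalkMap i q (at' q hq a) := by
  obtain ⟨V, hV, hpV, b, hb⟩ := h.surj U (ap (bigProj π) U s) p hp
  have ha : ∀ q (hq : q ∈ V), ∃ w, stalkMap i q w = (germ B q hq b)⁻¹ * bv q (hV hq) s := by
    intro q hq
    apply h.stalk_exact
    rw [map_mul, map_inv, stalkMap_germ, hb, germ_res, ← germ_bigProj, inv_mul_cancel]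
  choose a ha using ha
  exact ⟨V, hV, hpV, b, mkGod a, fun q hq => by rw [at'_mk, ha, mul_inv_cancel_left]⟩

lemma IsCentralExt.bigCont_normal (h : IsCentralExt i π) : (bigCont π).Normal where
  normal U := by
    refine ⟨fun n hn g => ?_⟩
    rw [mem_bigCont] at hn
    obtain ⟨b, hb⟩ := hn
    refine (bigCont π).local_mem _ fun p hp => ?_
    obtain ⟨V, hV, hpV, b', a, hab⟩ := h.big_local g p hp
    refine ⟨V, hV, hpV, (mem_bigCont _).2 ⟨b' * res B hV b * b'⁻¹, fun q hq => ?_⟩⟩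
    rw [bv_res, map_mul, map_mul, map_inv, hab q hq, hb, map_mul, map_mul, map_inv, germ_res,
      mul_inv_rev, mul_assoc (germ B q hq b'), h.stalk_central]
    group

/-- The sheaf of discontinuous sections of `A` modulo the continuous ones, in the form of the
quotient of `big π` by its continuous sections. -/
def bigQuot (h : IsCentralExt i π) : GrpSheaf X :=
  haveI := h.bigCont_normal
  quot (bigCont π)

/-- The projection of `big π` to `bigQuot`. -/
def bigQuotProj (h : IsCentralExt i π) : big π ⟶ bigQuot h :=
  haveI := h.bigCont_normal
  quotProj (bigCont π)

lemma IsShortExact.godMap_mem (h : IsShortExact i π) (U : Opens X) (s : Sec (god A) U) :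
    ap (godMap i) U s ∈ (ap (bigSub π).incl U).range :=
  ⟨⟨ap (godMap i) U s, 1, by
    refine god_ext fun p hp => ?_
    rw [map_one, map_one, at'_map, at'_map, h.stalk_comp]⟩, rfl⟩

/-- The inclusion of the discontinuous sections of `A` in `big π`. -/
def godToBig (h : IsShortExact i π) : god A ⟶ big π :=
  factor (bigSub π).incl (incl_injective _) (godMap i) h.godMap_mem

lemma bv_godToBig (h : IsShortExact i π) {U : Opens X} (s : Sec (god A) U) (p : X) (hp : p ∈ U) :
    bv p hp (ap (godToBig h) U s) = stalkMap i p (at' p hp s) := by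
  rw [← at'_map, bv, MonoidHom.comp_apply, godToBig, ap_factor]

/-- `1 ⟶ A ⟶ god A ⟶ bigQuot ⟶ 1` is exact. -/
lemma IsCentralExt.god_shortExact (h : IsCentralExt i π) :
    IsShortExact (godUnit A) (godToBig h.toIsShortExact ≫ bigQuotProj h) := by
  have := h.bigCont_normal
  refine ⟨godUnit_injective A, fun U s => ?_, fun U (c : Sec (quot (bigCont π)) U) p hp => ?_⟩
  · rw [ap_comp]
    refine (quotProj_eq_one (bigCont π) _).trans ?_
    rw [mem_bigCont]
    constructor
    · rintro ⟨b, hb⟩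
      have hb1 : ap π U b = 1 := sec_ext_germ C _ _ fun p hp => by
        rw [← stalkMap_germ, ← hb p hp, bv_godToBig, h.stalk_comp, map_one]
      obtain ⟨a, rfl⟩ := (h.exact U b).1 hb1
      refine ⟨a, god_ext fun p hp => h.stalk_inj p ?_⟩
      rw [at'_unit, stalkMap_germ, ← hb p hp, bv_godToBig]
    · rintro ⟨a, rfl⟩
      exact ⟨ap i U a, fun p hp => by rw [bv_godToBig, at'_unit, stalkMap_germ]⟩
  · obtain ⟨V, hV, hpV, s, hs⟩ := quot_local (bigCont π) c p hp
    obtain ⟨W, hW, hpW, b, a, hab⟩ := h.big_local s p hpV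
    refine ⟨W, hW.trans hV, hpW, a, ?_⟩
    have e1 : res (quot (bigCont π)) (hW.trans hV) c =  ap (quotProj (bigCont π)) W
        (res (big π) hW s) := by rw [ap_res, hs, res_res]
    refine Eq.trans ?_ e1.symm
    have : ap (quotProj (bigCont π)) W (res (big π) hW s *
        (ap (godToBig h.toIsShortExact) W a)⁻¹) = 1 := by
      rw [quotProj_eq_one, mem_bigCont]
      refine ⟨b, fun q hq => ?_⟩
      rw [map_mul, map_inv, bv_res, bv_godToBig, hab, mul_inv_cancel_right]
    rw [map_mul, map_inv, mul_inv_eq_one] at this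
    exact this.symm

lemma IsCentralExt.bigQuot_comm (h : IsCentralExt i π) : IsComm (bigQuot h) :=
  h.god_shortExact.comm h.comm.god

/-- Torsors under `C` lift to `big π`, uniquely up to isomorphism. -/
lemma IsShortExact.bigProj_surjective (h : IsShortExact i π) :
    Function.Surjective (H1.map (bigProj π)) := by
  intro c
  induction c using Quotient.inductionOn with | _ γ => ?_
  have hl : ∀ x p, ∀ hp : p ∈ γ.cov.set x, ∃ z : Stalk B p, stalkMap π p z =
      germ C p (mem_inf (γ.cov.mem p) hp)
        (val γ.cocycle p x inf_le_left inf_le_right) := fun x p hp => h.stalk_surj p _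
  choose l hl using hl
  have he : ∀ x y, ∃ e : Sec (big π) (γ.cov.set x ⊓ γ.cov.set y),
      (∀ p hp, bv p hp e = (l x p hp.1)⁻¹ * l y p hp.2) ∧
      ap (bigProj π) _ e = val γ.cocycle x y inf_le_left inf_le_right := by
    intro x y
    refine exists_big _ _ fun p hp => ?_
    have hW : p ∈ γ.cov.set p ⊓ (γ.cov.set x ⊓ γ.cov.set y) := ⟨γ.cov.mem p, hp⟩
    rw [map_mul, map_inv, hl, hl,
      ← germ_res C (le_inf inf_le_left (inf_le_right.trans inf_le_left)) p hW,
      ← germ_res C (le_inf inf_le_left (inf_le_right.trans inf_le_right)) p hW,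
      ← germ_res C inf_le_right p hW, val_res, val_res, val_res, ← map_inv, ← map_mul]
    congr 1
    rw [inv_mul_eq_iff_eq_mul, val_trans]
  choose e he he' using he
  have hc : ∀ x y z (V : Opens X) (hx : V ≤ γ.cov.set x) (hy : V ≤ γ.cov.set y)
      (hz : V ≤ γ.cov.set z), res (big π) (le_inf hx hy) (e x y) * res (big π) (le_inf hy hz) (e y z)
        = res (big π) (le_inf hx hz) (e x z) := by
    intro x y z V hx hy hz
    refine big_ext fun p hp => ?_
    rw [map_mul, bv_res, bv_res, bv_res, he, he, he]
    group
  refine ⟨Torsor.cls ⟨γ.cov, mkCocycle γ.cov.set e hc⟩, ?_⟩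
  rw [H1.map_cls]
  refine Quotient.sound ((Torsor.rel_iff _ _).2
    ⟨γ.cov, fun _ => le_rfl, fun _ => le_rfl, 1, fun x y V hx hy => ?_⟩)
  have : val (mapCocycle (bigProj π) (mkCocycle γ.cov.set e hc)) x y hx hy =
      val γ.cocycle x y hx hy := by
    rw [val_map, val_mk, ap_res, he', val_res]
  have e1 : res C hx ((1 : ∀ x, Sec C (γ.cov.set x)) x) = 1 := map_one _
  have e2 : res C hy ((1 : ∀ x, Sec C (γ.cov.set x)) y) = 1 := map_one _
  rw [e1, e2, one_mul, mul_one]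
  exact this

lemma IsShortExact.bigProj_injective (h : IsShortExact i π) :
    Function.Injective (H1.map (bigProj π)) := by
  intro c c' hcc
  induction c using Quotient.inductionOn with | _ γ => ?_
  induction c' using Quotient.inductionOn with | _ γ' => ?_
  obtain ⟨𝒲, h₁, h₂, f, hf⟩ := (Torsor.rel_iff _ _).1 (Quotient.exact hcc)
  replace h₁ : ∀ x, 𝒲.set x ≤ γ.cov.set x := h₁
  replace h₂ : ∀ x, 𝒲.set x ≤ γ'.cov.set x := h₂
  replace hf : ∀ x y (V : Opens X) (hx : V ≤ 𝒲.set x) (hy : V ≤ 𝒲.set y),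
      res C hx (f x) * ap (bigProj π) V (val γ.cocycle x y (hx.trans (h₁ x)) (hy.trans (h₁ y))) =
      ap (bigProj π) V (val γ'.cocycle x y (hx.trans (h₂ x)) (hy.trans (h₂ y))) * res C hy (f y) :=
    hf
  refine Quotient.sound ((Torsor.rel_iff _ _).2 ?_)
  have hl : ∀ p, ∃ z : Stalk B p, stalkMap π p z = germ C p (𝒲.mem p) (f p) :=
    fun p => h.stalk_surj p _
  choose l hl using hl
  have hv : ∀ x, ∃ v : Sec (big π) (𝒲.set x), (∀ p (hp : p ∈ 𝒲.set x), bv p hp v =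
      bv p (mem_inf hp (𝒲.mem p))
        (val γ'.cocycle x p (inf_le_left.trans (h₂ x)) (inf_le_right.trans (h₂ p))) * l p *
      bv p (mem_inf hp (𝒲.mem p))
        (val γ.cocycle p x (inf_le_right.trans (h₁ p)) (inf_le_left.trans (h₁ x)))) ∧
      ap (bigProj π) _ v = f x := by
    intro x
    refine exists_big _ _ fun p hp => ?_
    have hW : p ∈ 𝒲.set x ⊓ 𝒲.set p := ⟨hp, 𝒲.mem p⟩
    have e := hf p x _ (inf_le_right : 𝒲.set x ⊓ 𝒲.set p ≤ _) inf_le_left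
    have e' : ap (bigProj π) _ (val γ'.cocycle x p (inf_le_left.trans (h₂ x))
        (inf_le_right.trans (h₂ p))) * ap (bigProj π) _ (val γ'.cocycle p x
        (inf_le_right.trans (h₂ p)) (inf_le_left.trans (h₂ x) : 𝒲.set x ⊓ 𝒲.set p ≤ _)) = 1 := by
      rw [← map_mul, val_trans, val_self, map_one]
    rw [map_mul, map_mul, hl, ← germ_bigProj, ← germ_bigProj, ← germ_res C inf_le_left p hW (f x),
      ← germ_res C inf_le_right p hW (f p), ← map_mul, ← map_mul, mul_assoc, e, ← mul_assoc, e',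
      one_mul]
  choose v hv _ using hv
  refine ⟨𝒲, h₁, h₂, v, fun x y V hx hy => big_ext fun p hp => ?_⟩
  rw [map_mul, map_mul, bv_res, bv_res, hv, hv]
  have hW : p ∈ V ⊓ 𝒲.set p := ⟨hp, 𝒲.mem p⟩
  have r : ∀ (δ : Torsor (big π)) (h₃ : ∀ x, 𝒲.set x ≤ δ.cov.set x) (x y : X) (V' : Opens X)
      (hx : V' ≤ 𝒲.set x) (hy : V' ≤ 𝒲.set y) (hV' : V ⊓ 𝒲.set p ≤ V'),
      bv p (hV' hW) (val δ.cocycle x y (hx.trans (h₃ x)) (hy.trans (h₃ y))) =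
      bv p hW (val δ.cocycle x y (hV'.trans (hx.trans (h₃ x))) (hV'.trans (hy.trans (h₃ y)))) := by
    intro δ h₃ x y V' hx hy hV'
    rw [← val_res _ _ _ _ _ hV', bv_res]
  rw [r γ' h₂ x p (𝒲.set x ⊓ 𝒲.set p) inf_le_left inf_le_right (inf_le_inf_right _ hx),
    r γ h₁ p x (𝒲.set x ⊓ 𝒲.set p) inf_le_right inf_le_left (inf_le_inf_right _ hx),
    r γ' h₂ y p (𝒲.set y ⊓ 𝒲.set p) inf_le_left inf_le_right (inf_le_inf_right _ hy),
    r γ h₁ p y (𝒲.set y ⊓ 𝒲.set p) inf_le_right inf_le_left (inf_le_inf_right _ hy),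
    r γ h₁ x y V hx hy inf_le_left, r γ' h₂ x y V hx hy inf_le_left, mul_assoc, ← map_mul,
    val_trans, ← mul_assoc, ← mul_assoc, ← map_mul, val_trans]

/-- Torsors under `Q` become trivial in the sheaf of discontinuous sections of `Q`. -/
lemma delta1_god_surjective {Q R : GrpSheaf X} {ρ : god Q ⟶ R} (h : IsShortExact (godUnit Q) ρ) :
    Function.Surjective (delta1 h) := by
  intro q
  induction q using Quotient.inductionOn with | _ γ => ?_
  let b : ∀ x, Sec (god Q) (γ.cov.set x) := fun x => mkGod fun p hp =>
    germ Q p (mem_inf hp (γ.cov.mem p))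
      (val γ.cocycle x p inf_le_left inf_le_right)
  have hb : ∀ x y (V : Opens X) (hx : V ≤ γ.cov.set x) (hy : V ≤ γ.cov.set y),
      ap (godUnit Q) V (val γ.cocycle x y hx hy) =
        res (god Q) hx (b x) * (res (god Q) hy (b y))⁻¹ := by
    intro x y V hx hy
    refine god_ext fun p hp => ?_
    have hW : p ∈ V ⊓ γ.cov.set p := ⟨hp, γ.cov.mem p⟩
    rw [at'_unit, map_mul, map_inv, at'_res, at'_res, at'_mk, at'_mk,
      ← germ_res Q inf_le_left p hW,
      ← germ_res Q (inf_le_inf_right _ hx) p hW, ← germ_res Q (inf_le_inf_right _ hy) p hW,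
      val_res, val_res, val_res, ← map_inv, ← map_mul]
    congr 1
    rw [eq_mul_inv_iff_mul_eq, val_trans]
  obtain ⟨r, hr⟩ := sec_glue R (U := ⊤) (fun p => γ.cov.set p.1) (fun _ => le_top)
    (fun p => γ.cov.mem p.1) (fun p => ap ρ _ (b p.1)) (by
      intro p q
      rw [← ap_res, ← ap_res, ← mul_inv_eq_one, ← map_inv, ← map_mul, ← hb]
      exact (h.exact _ _).2 ⟨_, rfl⟩)
  exact ⟨r, (delta1_eq_iff h r _).2 ⟨γ, b, rfl, fun x => (hr ⟨x, trivial⟩).symm, hb⟩⟩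

/-- The second cohomology `H²(X, A)` of a commutative sheaf of groups. -/
abbrev H2 (A : GrpSheaf X) (hA : IsComm A) : Type u := Sheaf.H (ab A hA) 2

/-- The sheaf of discontinuous sections of `bigQuot h`, modulo `bigQuot h`. -/
abbrev bigCoker (h : IsCentralExt i π) : GrpSheaf X :=
  coker (godUnit (bigQuot h)) (godUnit_injective _) h.bigQuot_comm.god

/-- `1 ⟶ bigQuot ⟶ god bigQuot ⟶ bigCoker ⟶ 1` is exact. -/
lemma IsCentralExt.god_shortExact' (h : IsCentralExt i π) : IsShortExact (godUnit (bigQuot h))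
    (cokerProj (godUnit (bigQuot h)) (godUnit_injective _) h.bigQuot_comm.god) :=
  coker_shortExact _ _ _

lemma IsCentralExt.bigCoker_comm (h : IsCentralExt i π) : IsComm (bigCoker h) :=
  h.god_shortExact'.comm h.bigQuot_comm.god

/-- A global section, as a class in the degree zero cohomology of an abelian sheaf. -/
def toH0 (F : GrpSheaf X) (hF : IsComm F) (r : H0 F) : Sheaf.H (ab F hF) 0 :=
  (Sheaf.H.equiv₀ (ab F hF) Limits.isTerminalTop).symm (show AbSec F hF ⊤ from Additive.ofMul r)

/-- The iterated connecting map `H⁰(X, bigCoker) → H¹(X, bigQuot) → H²(X, A)` of the exact sequences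
`0 ⟶ bigQuot ⟶ god bigQuot ⟶ bigCoker ⟶ 0` and `0 ⟶ A ⟶ god A ⟶ bigQuot ⟶ 0`. -/
def connecting (h : IsCentralExt i π) (hA : IsComm A) (r : H0 (bigCoker h)) : H2 A hA :=
  ((toH0 (bigCoker h) h.bigCoker_comm r).comp
    (abComplex_shortExact h.god_shortExact' h.bigQuot_comm h.bigQuot_comm.god
      h.bigCoker_comm).extClass (zero_add 1)).comp
    (abComplex_shortExact h.god_shortExact hA hA.god h.bigQuot_comm).extClass one_add_one_eq_two

/-- `ξ` is the obstruction in `H²(X, A)` to lifting the class `c` of a `C`-torsor to `B`: the torsor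
is lifted to the extension `big π` of `C` by the discontinuous sections of `A`, and `ξ` is the image
of the resulting torsor under `bigQuot h` (that is, under the discontinuous sections of `A` modulo
the continuous ones) by the connecting map to `H²(X, A)`. That connecting map is computed by writing
the torsor under `bigQuot h` as the coboundary of a section `r` of `bigCoker h`. -/
def IsObstruction (h : IsCentralExt i π) (hA : IsComm A) (c : H1 C) (ξ : H2 A hA) : Prop :=
  ∃ (e : H1 (big π)) (r : H0 (bigCoker h)), H1.map (bigProj π) e = c ∧
    delta1 h.god_shortExact' r = H1.map (bigQuotProj h) e ∧ connecting h hA r = ξ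

lemma toH0_mul (F : GrpSheaf X) (hF : IsComm F) (r s : H0 F) :
    toH0 F hF (r * s) = toH0 F hF r + toH0 F hF s :=
  map_add (Sheaf.H.equiv₀ (ab F hF) Limits.isTerminalTop).symm
    (show AbSec F hF ⊤ from Additive.ofMul r) (show AbSec F hF ⊤ from Additive.ofMul s)

lemma connecting_mul (h : IsCentralExt i π) (hA : IsComm A) (r s : H0 (bigCoker h)) :
    connecting h hA (r * s) = connecting h hA r + connecting h hA s := by
  unfold connecting
  rw [toH0_mul, Abelian.Ext.add_comp, Abelian.Ext.add_comp]

lemma toH0_ap {F F' : GrpSheaf X} (f : F ⟶ F') (hF : IsComm F) (hF' : IsComm F') (s : H0 F) :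
    toH0 F' hF' (ap f ⊤ s) = (toH0 F hF s).comp (Abelian.Ext.mk₀ (abMap f hF hF')) (add_zero 0) :=
  (Sheaf.H.equiv₀_symm_naturality (T := (⊤ : Opens X)) Limits.isTerminalTop
    (abMap f hF hF') (show AbSec F hF ⊤ from Additive.ofMul s)).symm

lemma toH0_comp_extClass {A' B' C' : GrpSheaf X} {i' : A' ⟶ B'} {π' : B' ⟶ C'}
    (h : IsShortExact i' π') (hA : IsComm A') (hB : IsComm B') (hC : IsComm C') (s : H0 B') :
    (toH0 C' hC (ap π' ⊤ s)).comp (abComplex_shortExact h hA hB hC).extClass (zero_add 1) = 0 := by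
  rw [toH0_ap π' hB hC]
  rw [Abelian.Ext.comp_assoc (a₁₂ := 0) (a₂₃ := 1) (h := by omega)]
  refine (congrArg (fun w => Abelian.Ext.comp _ w _)
    (abComplex_shortExact h hA hB hC).comp_extClass).trans ?_
  exact Abelian.Ext.comp_zero ..

lemma connecting_proj (h : IsCentralExt i π) (hA : IsComm A) (b : H0 (god (bigQuot h))) :
    connecting h hA (ap (cokerProj (godUnit (bigQuot h)) (godUnit_injective _)
      h.bigQuot_comm.god) ⊤ b) = 0 := by
  unfold connecting
  rw [toH0_comp_extClass h.god_shortExact' h.bigQuot_comm h.bigQuot_comm.god h.bigCoker_comm b,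
    Abelian.Ext.zero_comp]

lemma existsUnique_obstruction (h : IsCentralExt i π) (hA : IsComm A) (c : H1 C) :
    ∃! ξ, IsObstruction h hA c ξ := by
  obtain ⟨e, he⟩ := h.bigProj_surjective c
  obtain ⟨r, hr⟩ := delta1_god_surjective h.god_shortExact' (H1.map (bigQuotProj h) e)
  refine ⟨_, ⟨e, r, he, hr, rfl⟩, ?_⟩
  rintro _ ⟨e', r', he', hr', rfl⟩
  obtain rfl : e' = e := h.bigProj_injective (he'.trans he.symm)
  obtain ⟨b, hb⟩ := delta1_eq_delta1 h.god_shortExact' (hr.trans hr'.symm)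
  have hrr : r' = r * ap (cokerProj (godUnit (bigQuot h)) (godUnit_injective _)
      h.bigQuot_comm.god) ⊤ b := by rw [hb, mul_inv_cancel_left]
  rw [hrr, connecting_mul, connecting_proj, add_zero]

/-- The connecting map `δ² : Ȟ¹(X, C) → H²(X, A)` of a central extension `1 ⟶ A ⟶ B ⟶ C ⟶ 1` of
sheaves of groups. -/
def delta2 (h : IsCentralExt i π) (hA : IsComm A) (c : H1 C) : H2 A hA :=
  (existsUnique_obstruction h hA c).choose

end Ext

/-! ### Sheaves of AQ normal series -/

/-- A sheaf of AQ normal series on `X`: a decreasing sequence `G = H 0 ⊇ H 1 ⊇ H 2 ⊇ ⋯` of subsheaves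
of normal subgroups with commutative successive quotients `H j / H (j + 1)`. -/
structure AQNormalSeries (G : GrpSheaf X) where
  H : ℕ → SubgrpSheaf G
  zero : ∀ U, (H 0).sec U = ⊤
  succ_le : ∀ j U, (H (j + 1)).sec U ≤ (H j).sec U
  [normal : ∀ j, (H j).Normal]
  comm : ∀ j, IsComm (quot ((H (j + 1)).comap (H j).incl))

namespace AQNormalSeries

variable {G : GrpSheaf X} (S : AQNormalSeries G)

instance (j : ℕ) : (S.H j).Normal := S.normal j

lemma le {k j : ℕ} (h : k ≤ j) (U : Opens X) : (S.H j).sec U ≤ (S.H k).sec U := by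
  induction j, h using Nat.le_induction with
  | base => exact le_rfl
  | succ n _ ih => exact (S.succ_le n U).trans ih

/-- The quotient sheaf `H k / H m`, for `k ≤ m`. -/
abbrev Q (k m : ℕ) : GrpSheaf X := quot ((S.H m).comap (S.H k).incl)

/-- The successive quotients `A j = H j / H (j + 1)`, whose direct sum is the linearisation. -/
abbrev A (j : ℕ) : GrpSheaf X := S.Q j (j + 1)

/-- The inclusion `H j ⟶ H k`, for `k ≤ j`. -/
def inclusion {k j : ℕ} (h : k ≤ j) : (S.H j).toSheaf ⟶ (S.H k).toSheaf :=
  ⟨{ app := fun U => GrpCat.ofHom (Subgroup.inclusion (S.le h U.unop))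
     naturality := fun _ _ _ => rfl }⟩

/-- The morphism `H j / H m ⟶ H k / H m` induced by the inclusion, for `k ≤ j`. -/
def quotIncl {k j : ℕ} (h : k ≤ j) (m : ℕ) : S.Q j m ⟶ S.Q k m :=
  quotMap (S.inclusion h) _ _ (fun _ _ hs => hs)

/-- The projection `H k / H m ⟶ H k / H j`, for `j ≤ m`. -/
def quotTo (k : ℕ) {j m : ℕ} (h : j ≤ m) : S.Q k m ⟶ S.Q k j :=
  quotMap (𝟙 _) _ _ (fun U _ hs => S.le h U hs)

/-- `1 ⟶ H j / H (j + 1) ⟶ H k / H (j + 1) ⟶ H k / H j ⟶ 1` is exact, for `k ≤ j`. -/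
lemma shortExact {k j : ℕ} (h : k ≤ j) :
    IsShortExact (S.quotIncl h (j + 1)) (S.quotTo k (Nat.le_succ j)) :=
  isShortExact_quot (S.inclusion h) _ _ _ (fun _ _ => Iff.rfl) (fun _ _ hs => hs)
    (fun U _ hs => S.le (Nat.le_succ j) U hs)
    (fun _ s => ⟨fun hs => ⟨⟨s.1, hs⟩, rfl⟩, fun ⟨t, ht⟩ => ht ▸ t.2⟩)

/-- `H j / H (j + 1)` is contained in the centre of `H k / H (j + 1)`. -/
def CentralAt {k j : ℕ} (h : k ≤ j) : Prop :=
  ∀ U (a : Sec (S.A j) U) (b : Sec (S.Q k (j + 1)) U),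
    ap (S.quotIncl h (j + 1)) U a * b = b * ap (S.quotIncl h (j + 1)) U a

/-- The series is central: for every `j > 0` there is some `k < j` such that `H j / H (j + 1)` is
contained in the centre of `H k / H (j + 1)`. -/
def IsCentral : Prop := ∀ j, 0 < j → ∃ (k : ℕ) (h : k < j), S.CentralAt h.le

/-- A choice of indices `k j < j` which shows that the series is central. -/
structure CentralIndices where
  k : ℕ → ℕ
  lt : ∀ j, 0 < j → k j < j
  central : ∀ j (hj : 0 < j), S.CentralAt (lt j hj).le

lemma isCentral_iff : S.IsCentral ↔ Nonempty S.CentralIndices := by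
  constructor
  · intro h
    choose k hk hc using h
    refine ⟨⟨fun j => if hj : 0 < j then k j hj else 0, fun j hj => ?_, fun j hj => ?_⟩⟩
    · simpa only [dif_pos hj] using hk j hj
    · have : ∀ (l : ℕ) (hl : l ≤ j), l = k j hj → S.CentralAt hl := by
        rintro _ hl rfl
        exact hc j hj
      exact this _ _ (dif_pos hj)
  · rintro ⟨K⟩ j hj
    exact ⟨K.k j, K.lt j hj, K.central j hj⟩

variable {S} (K : S.CentralIndices)

lemma CentralIndices.le (j : ℕ) : K.k (j + 1) ≤ j := Nat.lt_succ_iff.1 (K.lt (j + 1) j.succ_pos)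

/-- With `k < j + 1` the chosen index, `A (j + 1) ⟶ H k / H (j + 2) ⟶ H k / H (j + 1)` is a central
extension. -/
lemma CentralIndices.centralExt (j : ℕ) :
    IsCentralExt (S.quotIncl (K.lt (j + 1) j.succ_pos).le (j + 1 + 1))
      (S.quotTo (K.k (j + 1)) (Nat.le_succ (j + 1))) :=
  ⟨S.shortExact _, K.central (j + 1) j.succ_pos⟩

/-- The first map `H⁰(X, A j) → H¹(X, A (j + 1))` of the primary complex:
`H⁰(X, A j) → H⁰(X, H k / H (j + 1)) → H¹(X, A (j + 1))`, the second map being the connecting map. -/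
def CentralIndices.d1 (j : ℕ) (θ : H0 (S.A j)) : H1 (S.A (j + 1)) :=
  delta1 (K.centralExt j).toIsShortExact (ap (S.quotIncl (K.le j) (j + 1)) ⊤ θ)

/-- The second map `H¹(X, A j) → H²(X, A (j + 1))` of the primary complex:
`H¹(X, A j) → Ȟ¹(X, H k / H (j + 1)) → H²(X, A (j + 1))`, the second map being the connecting map. -/
def CentralIndices.d2 (j : ℕ) (θ : H1 (S.A j)) : H2 (S.A (j + 1)) (S.comm (j + 1)) :=
  delta2 (K.centralExt j) (S.comm (j + 1)) (H1.map (S.quotIncl (K.le j) (j + 1)) θ)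

/-- The image in `H¹(X, A j)` of the first map of the primary complex, where `A (-1)` is trivial. -/
def CentralIndices.boundaries : ∀ j, Set (H1 (S.A j))
  | 0 => {1}
  | j + 1 => Set.range (K.d1 j)

/-- The component of degree `j` of the first primary cohomology: the pointed set obtained from the
kernel of `d2` by collapsing the image of `d1` to a point. -/
def CentralIndices.PrimaryH1 (j : ℕ) : Type u :=
  Quot fun θ θ' : {θ : H1 (S.A j) // K.d2 j θ = 0} =>
    θ.1 ∈ K.boundaries j ∧ θ'.1 ∈ K.boundaries j

/-- The first primary cohomology vanishes: all its components are reduced to the base point. -/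
def CentralIndices.FirstPrimaryVanishes : Prop := ∀ j, Subsingleton (K.PrimaryH1 j)

variable (S)

/-- The linearisation map `Ȟ¹(X, H j) → H¹(X, A j)`, induced by the projection. -/
def linearisation (j : ℕ) : H1 (S.H j).toSheaf → H1 (S.A j) :=
  H1.map (quotProj ((S.H (j + 1)).comap (S.H j).incl))

/-- The class `θ` is the linearisation of some `H j`-torsor. -/
def Integrates (j : ℕ) (θ : H1 (S.A j)) : Prop := ∃ h, S.linearisation j h = θ

end AQNormalSeries

end

end AQ

namespace AQ

noncomputable section

variable {X : TopCat.{u}}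

/-! Everything comes from one morphism of short exact sequences. For `k = K.k (j + 1)`, the sequence
`1 ⟶ H (j + 1) ⟶ H j ⟶ A j ⟶ 1` maps to the central extension `1 ⟶ A (j + 1) ⟶ H k / H (j + 2) ⟶ H k
/ H (j + 1) ⟶ 1` which defines the two differentials. The left vertical map is the linearisation
projection of `H (j + 1)`, the middle one is inclusion in `H k` followed by the projection, and the
right one is the inclusion of `A j`.

Necessity uses the right-hand square (`proj_quotIncl`). If `θ` is the linearisation of an `H
j`-torsor, its image in `Ȟ¹(X, H k / H (j + 1))` is also the image of that torsor through `Ȟ¹(X, H k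
/ H (j + 2))`, hence comes from the middle term of the central extension. The map `δ²` kills such
classes (`delta2_map`). With `δ²` defined through discontinuous sections the reason is direct: a
class coming from `B` lifts to `big π` by continuous sections, and these die in `bigQuot`, so the
section `r` whose iterated coboundary is the obstruction may be taken trivial.

Sufficiency uses the whole diagram. Vanishing of the primary cohomology says that a class killed by
the second differential is a boundary. Boundaries are always linearisations: in degree `0` the only
boundary is the base point, which linearises the trivial torsor. In degree `j + 1` a boundary is
`K.d1 j σ` for a global section `σ` of `A j`, and by naturality of `δ¹` (`delta1_naturality`) it is
the linearisation of the `H (j + 1)`-torsor of local lifts of `σ` to `H j`. This torsor exists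
although `H (j + 1)` need not be commutative, because `δ¹` is defined for every short exact
sequence. Thus no successive lifting along the series and no limit argument is needed. -/

/-! ### Induced maps on `Ȟ¹` and the trivial class. -/

lemma H1.map_comp {F G K : GrpSheaf X} (f : F ⟶ G) (g : G ⟶ K) (c : H1 F) :
    H1.map (f ≫ g) c = H1.map g (H1.map f c) := by
  induction c using Quotient.inductionOn with | _ γ => rfl

lemma hom_ext_ap {F G : GrpSheaf X} {f g : F ⟶ G} (h : ∀ U s, ap f U s = ap g U s) : f = g := by
  ext U s
  exact h U.unop s

/-- The base point of `H1 F` is represented on the covering by copies of `X`, which every covering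
refines; the comparison therefore takes place on the covering of `γ` itself, with trivial
`0`-cochain. -/
lemma Torsor.cls_eq_one {F : GrpSheaf X} (γ : Torsor F)
    (h : ∀ x y (V : Opens X) (hx : V ≤ γ.cov.set x) (hy : V ≤ γ.cov.set y),
      val γ.cocycle x y hx hy = 1) : γ.cls = 1 := by
  refine Quotient.sound ((Torsor.rel_iff _ _).2
    ⟨γ.cov, fun _ => le_rfl, fun _ => le_top, fun _ => 1, fun x y V hx hy => ?_⟩)
  rw [h, map_one, map_one]
  rfl

/-- A morphism which is trivial on sections induces the trivial map on `Ȟ¹`. -/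
lemma H1.map_of_trivial {F G : GrpSheaf X} (f : F ⟶ G) (hf : ∀ U s, ap f U s = 1) (c : H1 F) :
    H1.map f c = 1 := by
  induction c using Quotient.inductionOn with | _ γ => ?_
  exact Torsor.cls_eq_one (γ.map f) fun x y V hx hy => hf V _

lemma H1.map_one {F G : GrpSheaf X} (f : F ⟶ G) : H1.map f 1 = 1 :=
  Torsor.cls_eq_one _ fun _ _ V _ _ => (ap f V).map_one

/-! ### The connecting map in degree zero. -/

/-- The section `1` of `B` is a global lift, and its coboundary is trivial. -/
lemma delta1_one {A B C : GrpSheaf X} {i : A ⟶ B} {π : B ⟶ C} (h : IsShortExact i π) :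
    delta1 h 1 = 1 := by
  refine (delta1_eq_iff h _ _).2 ⟨⟨⟨fun _ => ⊤, fun _ => trivial⟩, 1⟩, fun _ => 1, rfl,
    fun x => ?_, fun x y V hx hy => ?_⟩
  · exact (map_one _).trans (map_one _).symm
  · rw [(res B hx).map_one, inv_one, mul_one]
    exact (ap i V).map_one

/-- Compatibility of the connecting maps in degree zero with morphisms of exact sequences. -/
lemma delta1_naturality {A B C A' B' C' : GrpSheaf X} {i : A ⟶ B} {π : B ⟶ C} {i' : A' ⟶ B'}
    {π' : B' ⟶ C'} (h : IsShortExact i π) (h' : IsShortExact i' π') (f : A ⟶ A') (g : B ⟶ B')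
    (k : C ⟶ C') (hi : ∀ U s, ap g U (ap i U s) = ap i' U (ap f U s))
    (hπ : ∀ U s, ap k U (ap π U s) = ap π' U (ap g U s)) (c : H0 C) :
    delta1 h' (ap k ⊤ c) = H1.map f (delta1 h c) := by
  obtain ⟨γ, b, hγ, hb, hab⟩ := (delta1_eq_iff h c _).1 rfl
  -- The covering is kept: `g` carries local lifts of `c` to local lifts of its image, and `f`
  -- carries the cocycle of their quotients to that of the new ones.
  refine (delta1_eq_iff h' _ _).2 ⟨γ.map f, fun x => ap g _ (b x), ?_, fun x => ?_,
    fun x y V hx hy => ?_⟩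
  · rw [← hγ, H1.map_cls]
  · exact (hπ _ _).symm.trans ((congrArg (ap k _) (hb x)).trans (ap_res k _ c))
  · have e := congrArg (ap g V) (hab x y V hx hy)
    rw [hi, map_mul, map_inv] at e
    exact e.trans (congrArg₂ (· * ·⁻¹) (ap_res g hx (b x)) (ap_res g hy (b y)))

/-- `1 ⟶ M ⟶ F ⟶ F / N ⟶ 1` is exact when `M ⟶ F` is a monomorphism with image `N`. -/
lemma isShortExact_quotProj {M F : GrpSheaf X} (m : M ⟶ F)
    (hm : ∀ U, Function.Injective (ap m U)) (N : SubgrpSheaf F) [N.Normal]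
    (hN : ∀ U s, s ∈ N.sec U ↔ ∃ t, ap m U t = s) : IsShortExact m (quotProj N) where
  inj := hm
  exact U b := (quotProj_eq_one N b).trans (hN U b)
  surj _ c p hp := quot_local N c p hp

/-! ### The connecting map in degree one on classes from the middle term. -/

section Ext

variable {A B C : GrpSheaf X} {i : A ⟶ B} {π : B ⟶ C}

/-- The family of germs of `s` has as image in the stalks of `C` the family of germs of `π s`, which
is continuous. -/
lemma godUnit_mem_bigSub (π : B ⟶ C) (U : Opens X) (s : Sec B U) :
    ap (godUnit B) U s ∈ (ap (bigSub π).incl U).range :=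
  ⟨⟨ap (godUnit B) U s, ap π U s, rfl⟩, rfl⟩

/-- The inclusion of `B` in `big π` as the sheaf of continuous sections. -/
def toBig (π : B ⟶ C) : B ⟶ big π :=
  factor (bigSub π).incl (incl_injective _) (godUnit B) (godUnit_mem_bigSub π)

lemma bv_toBig {U : Opens X} (s : Sec B U) (p : X) (hp : p ∈ U) :
    bv p hp (ap (toBig π) U s) = germ B p hp s := by
  rw [bv, MonoidHom.comp_apply, toBig, ap_factor, at'_unit]

/-- With this, pushing a class of `B` into `big π` gives an admissible lift of its image in `C`.
Sections of `C` are determined by their germs, where the identity is read off. -/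
lemma toBig_bigProj (π : B ⟶ C) : toBig π ≫ bigProj π = π := by
  refine hom_ext_ap fun U s => sec_ext_germ C _ _ fun p hp => ?_
  rw [ap_comp, germ_bigProj, bv_toBig, stalkMap_germ]

/-- `bigQuot` is the quotient by exactly the continuous sections, and those are the image of
`toBig`. -/
lemma toBig_bigQuotProj (h : IsCentralExt i π) (U : Opens X) (s : Sec B U) :
    ap (toBig π ≫ bigQuotProj h) U s = 1 := by
  have := h.bigCont_normal
  exact (quotProj_eq_one (bigCont π) _).2 ((mem_bigCont _).2 ⟨s, fun p hp => bv_toBig s p hp⟩)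

lemma connecting_one (h : IsCentralExt i π) (hA : IsComm A) : connecting h hA 1 = 0 := by
  have := connecting_mul h hA 1 1
  -- Additivity gives `c = c + c` for the value `c` at `1`, so `c = 0`.
  rwa [mul_one, left_eq_add] at this

/-- The obstruction to lifting a class which comes from `B` is zero. -/
lemma delta2_map (h : IsCentralExt i π) (hA : IsComm A) (b : H1 B) :
    delta2 h hA (H1.map π b) = 0 := by
  -- The obstruction is unique, so it suffices to realise `0` as one.
  refine ((existsUnique_obstruction h hA _).unique
    (existsUnique_obstruction h hA _).choose_spec.1 ?_)
  -- The chosen lift to `big π` is `b` itself, seen as a class of continuous sections; its image in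
  -- `bigQuot` is trivial, hence the coboundary of `r = 1`.
  refine ⟨H1.map (toBig π) b, 1, ?_, ?_, connecting_one h hA⟩
  · rw [← H1.map_comp, toBig_bigProj]
  · rw [← H1.map_comp, H1.map_of_trivial _ (toBig_bigQuotProj h), delta1_one]

end Ext

/-! ### Linearisations of torsors and the primary complex. -/

namespace AQNormalSeries

variable {G : GrpSheaf X} (S : AQNormalSeries G)

/-- The projection `H k ⟶ H k / H m`. -/
abbrev proj (k m : ℕ) : (S.H k).toSheaf ⟶ S.Q k m := quotProj ((S.H m).comap (S.H k).incl)

/-- The projection `H j ⟶ A j`, followed by the inclusion in `H k / H (j + 1)`, factors through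
`H k / H (j + 2)`. -/
lemma proj_quotIncl {k j : ℕ} (h : k ≤ j) :
    S.proj j (j + 1) ≫ S.quotIncl h (j + 1) =
      (S.inclusion h ≫ S.proj k (j + 1 + 1)) ≫ S.quotTo k (Nat.le_succ (j + 1)) :=
  -- Both sides send a section of `H j` to the family of its germs in the stalks of `H k`, taken
  -- modulo those of `H (j + 1)`.
  hom_ext_ap fun _ _ => rfl

/-- `1 ⟶ H (j + 1) ⟶ H j ⟶ A j ⟶ 1` is exact. -/
lemma shortExact_proj (j : ℕ) : IsShortExact (S.inclusion (Nat.le_succ j)) (S.proj j (j + 1)) :=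
  isShortExact_quotProj (S.inclusion (Nat.le_succ j)) (fun U => Subgroup.inclusion_injective (S.le (Nat.le_succ j) U)) _
    fun _ s => ⟨fun hs => ⟨⟨s.1, hs⟩, rfl⟩, fun ⟨t, ht⟩ => ht ▸ t.2⟩

lemma integrates_one (j : ℕ) : S.Integrates j 1 := ⟨1, H1.map_one _⟩

variable {S} (K : S.CentralIndices)

/-- The differential of the primary complex vanishes on the linearisations of torsors. -/
lemma CentralIndices.d2_eq_zero {j : ℕ} {θ : H1 (S.A j)} (hθ : S.Integrates j θ) :
    K.d2 j θ = 0 := by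
  obtain ⟨t, rfl⟩ := hθ
  -- After this the argument of `delta2` is the image of a class of `H k / H (j + 2)`, the middle
  -- term of the central extension.
  rw [d2, linearisation, ← H1.map_comp, S.proj_quotIncl (K.le j), H1.map_comp]
  exact delta2_map _ _ _

/-- The image of the first map of the primary complex consists of linearisations of torsors, namely
of those which arise from the exact sequences `1 ⟶ H (j + 1) ⟶ H j ⟶ A j ⟶ 1`. -/
lemma CentralIndices.integrates_d1 (j : ℕ) (σ : H0 (S.A j)) : S.Integrates (j + 1) (K.d1 j σ) :=
  -- The witness is the torsor of local lifts of `σ` to `H j`. The three vertical maps start from `H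
  -- (j + 1)`, `H j` and `A j`; the first induces the linearisation, the last is the inclusion used
  -- in `d1`.
  ⟨delta1 (S.shortExact_proj j) σ, (delta1_naturality (S.shortExact_proj j)
    (K.centralExt j).toIsShortExact (S.proj (j + 1) (j + 1 + 1))
    (S.inclusion (K.le j) ≫ S.proj (K.k (j + 1)) (j + 1 + 1)) (S.quotIncl (K.le j) (j + 1))
    (fun _ _ => rfl) (fun _ _ => rfl) σ).symm⟩

lemma CentralIndices.integrates_of_mem_boundaries :
    ∀ {j : ℕ} {θ : H1 (S.A j)}, θ ∈ K.boundaries j → S.Integrates j θ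
  | 0, _, rfl => S.integrates_one 0
  | j + 1, _, ⟨σ, rfl⟩ => K.integrates_d1 j σ

/-- This provides the base point against which other classes are compared in the collapsed quotient.
-/
lemma CentralIndices.one_mem_boundaries : ∀ j, (1 : H1 (S.A j)) ∈ K.boundaries j
  | 0 => rfl
  | j + 1 => ⟨1, by rw [d1, map_one, delta1_one]⟩

/-- If the first primary cohomology vanishes, the kernel of the second map of the primary complex is
contained in the image of the first. -/
lemma CentralIndices.FirstPrimaryVanishes.mem_boundaries {K : S.CentralIndices}
    (hK : K.FirstPrimaryVanishes) {j : ℕ} {θ : H1 (S.A j)} (hθ : K.d2 j θ = 0) :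
    θ ∈ K.boundaries j := by
  -- The collapsing relation only links two boundaries, so being a boundary is a well-defined
  -- predicate on the quotient. It holds at the base point, hence everywhere once the quotient has a
  -- single element.
  let f : K.PrimaryH1 j → Prop := Quot.lift (fun θ => θ.1 ∈ K.boundaries j)
    fun _ _ h => propext ⟨fun _ => h.2, fun _ => h.1⟩
  -- The base point lies in the kernel because it is the linearisation of the trivial torsor.
  have e := (hK j).elim (Quot.mk _ ⟨1, K.d2_eq_zero (S.integrates_one j)⟩) (Quot.mk _ ⟨θ, hθ⟩)
  exact (congrArg f e).mp (K.one_mem_boundaries j)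

end AQNormalSeries

end

end AQ

theorem mainTheorem4 {X : TopCat.{u}} {G : AQ.GrpSheaf X} (S : AQ.AQNormalSeries G)
    (K : S.CentralIndices) :
    (∀ (j : ℕ) (θ : AQ.H1 (S.A j)), S.Integrates j θ → K.d2 j θ = 0) ∧
      (K.FirstPrimaryVanishes →
        ∀ (j : ℕ) (θ : AQ.H1 (S.A j)), S.Integrates j θ ↔ K.d2 j θ = 0) :=
  ⟨fun _ _ => K.d2_eq_zero, fun hK _ _ =>
    -- Kernel elements are boundaries by vanishing, and boundaries are linearisations
    -- unconditionally.
    ⟨K.d2_eq_zero, fun hθ => K.integrates_of_mem_boundaries (hK.mem_boundaries hθ)⟩⟩
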